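/- Let $B>0$ and let $L^2[0,B]$ be the real Hilbert space of square integrable functions on $[0,B]$ with Lebesgue measure. The restricted call operator $\gamma$ and the restricted put operator $\gamma^*$ are the bounded operators on $L^2[0,B]$ given by $$(\gamma f)(\xi)=\int_0^B (x-\xi)^+f(x)\,dx,\qquad (\gamma^* f)(\xi)=\int_0^B(\xi-x)^+f(x)\,dx,\qquad \xi\in[0,B].$$ For $k\in\mathbb N=\{0,1,2,\dots\}$ let $\beta_k$ be the smallest positive solution $u$ of $$\exp\!\big(\tfrac{\pi}{2}+k\pi+(-1)^k u\big)=\frac{1+\cos u}{\sin u},$$ and put $\rho_k=\frac{\pi}{2}+k\pi+(-1)^k\beta_k$, $\lambda_k=(B/\rho_k)^2$, $$a_{k,1}=\frac1{\sqrt B}\,\frac{(-1)^k}{e^{\rho_k}+(-1)^k},\qquad a_{k,2}=(-1)^k e^{\rho_k}a_{k,1}=\frac1{\sqrt B}\,\frac1{1+(-1)^k e^{-\rho_k}},$$ $$a_{k,3}=-\frac1{\sqrt B},\qquad a_{k,4}=\frac1{\sqrt B}\,\frac{1-(-1)^k e^{-\rho_k}}{1+(-1)^k e^{-\rho_k}},$$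 $$h_{k,1}(\xi)=a_{k,1}e^{\rho_k\xi/B}+a_{k,2}e^{-\rho_k\xi/B},\qquad h_{k,2}(\xi)=a_{k,3}\cos(\rho_k\xi/B)+a_{k,4}\sin(\rho_k\xi/B),$$ $$\phi_k=h_{k,1}+h_{k,2},\qquad \psi_k=h_{k,1}-h_{k,2}.$$ **Theorem.** The smallest positive solutions $\beta_k$ exist, the numbers $\rho_k$ and $\lambda_k$ are positive, the sequence $(\lambda_k)$ is strictly decreasing, the two expressions for $a_{k,2}$ agree, and $\gamma^*$ is the Hilbert space adjoint of $\gamma$. Moreover: 1. $(\phi_k)_{k\ge0}$ and $(\psi_k)_{k\ge 0}$ are complete orthonormal systems of eigenvectors in $L^2[0,B]$ of $\gamma^*\gamma$ and $\gamma\gamma^*$, respectively. The eigenvalues of each of these two operators are exactly the numbers $\lambda_k^2$, $k\ge0$, and the eigenspaces for $\lambda_k^2$ are the lines spanned by $\phi_k$ and $\psi_k$, respectively. For every $k\ge 0$: 2. $\gamma\phi_k=\lambda_k\psi_k$ and $\gamma^*\psi_k=\lambda_k\phi_k$, both in $L^2[0,B]$ and pointwise on $[0,B]$. 3. $\|\phi_k\|_{L^2[0,B]}=\|\psi_k\|_{L^2[0,B]}=1$.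 4. $\psi_k(B)=\psi_k'(B)=0$ and $\phi_k(0)=\phi_k'(0)=0$. 5. $\psi_k(B-\xi)=(-1)^k\phi_k(\xi)$ and $\phi_k(B-\xi)=(-1)^k\psi_k(\xi)$ for all $\xi\in[0,B]$. 6. The functions $\phi_k$, $\psi_k$, $\gamma\phi_k$, $\gamma^*\psi_k$ are twice continuously differentiable on $[0,B]$ (one-sided derivatives at the end points), and on $[0,B]$ $$\lambda_k\,\partial_\xi^2\psi_k=\partial_\xi^2(\gamma\phi_k)=\phi_k,\qquad \lambda_k\,\partial_\xi^2\phi_k=\partial_\xi^2(\gamma^*\psi_k)=\psi_k .$$ -/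

import Mathlib

open MeasureTheory Set

noncomputable section

namespace RestrictedOptions

/-! ### The space `L²[0, B]` and the restricted call and put operators -/

/-- Lebesgue measure on the segment `[0, B]`. -/
abbrev segMeasure (B : ℝ) : Measure ℝ := volume.restrict (Icc 0 B)

/-- The real Hilbert space `L²[0, B]`. -/
abbrev L2Seg (B : ℝ) : Type := Lp ℝ 2 (segMeasure B)

/-- The call payoff kernel `θ(ξ, x) = (x - ξ)⁺`. -/
def theta (ξ x : ℝ) : ℝ := max (x - ξ) 0

/-- The put payoff kernel `θ*(ξ, x) = θ(x, ξ)`. -/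
def thetaStar (ξ x : ℝ) : ℝ := theta x ξ

/-- The function `ξ ↦ ∫_{[0, B]} θ(ξ, x) f(x) dx`. -/
def callFun (B : ℝ) (f : ℝ → ℝ) (ξ : ℝ) : ℝ := ∫ x in Icc 0 B, theta ξ x * f x

/-- The function `ξ ↦ ∫_{[0, B]} θ*(ξ, x) f(x) dx`. -/
def putFun (B : ℝ) (f : ℝ → ℝ) (ξ : ℝ) : ℝ := ∫ x in Icc 0 B, thetaStar ξ x * f x

theorem continuous_theta : Continuous (fun p : ℝ × ℝ => theta p.1 p.2) := by
  unfold theta; fun_prop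

theorem continuous_thetaStar : Continuous (fun p : ℝ × ℝ => thetaStar p.1 p.2) := by
  unfold thetaStar theta; fun_prop

theorem abs_theta_le (B ξ x : ℝ) (hξ : ξ ∈ Icc 0 B) (hx : x ∈ Icc 0 B) :
    |theta ξ x| ≤ |B| := by
  obtain ⟨h1, h2⟩ := hξ
  obtain ⟨h3, h4⟩ := hx
  unfold theta
  rw [abs_of_nonneg (le_max_right _ _), abs_of_nonneg (h1.trans h2)]
  exact max_le (by linarith) (by linarith)

theorem abs_thetaStar_le (B ξ x : ℝ) (hξ : ξ ∈ Icc 0 B) (hx : x ∈ Icc 0 B) :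
    |thetaStar ξ x| ≤ |B| := abs_theta_le B x ξ hx hξ

/-- A continuous function on the line restricts to an element of `L²[0, B]`. -/
theorem memLp_of_continuous (B : ℝ) {f : ℝ → ℝ} (hf : Continuous f) :
    MemLp f 2 (segMeasure B) := by
  obtain ⟨C, hC⟩ := isCompact_Icc.exists_bound_of_continuousOn (s := Icc 0 B) hf.continuousOn
  refine MemLp.of_bound hf.aestronglyMeasurable C ?_
  filter_upwards [ae_restrict_mem measurableSet_Icc] with x hx using hC x hx

/-- The class in `L²[0, B]` of a continuous function. -/
def toL2 (B : ℝ) (f : ℝ → ℝ) (hf : Continuous f) : L2Seg B :=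
  (memLp_of_continuous B hf).toLp f

theorem continuous_section {K : ℝ → ℝ → ℝ} (hK : Continuous (fun p : ℝ × ℝ => K p.1 p.2))
    (ξ : ℝ) : Continuous (K ξ) :=
  hK.comp (Continuous.prodMk continuous_const continuous_id)

theorem integral_kernel_eq_inner {B : ℝ} {K : ℝ → ℝ → ℝ}
    (hK : Continuous (fun p : ℝ × ℝ => K p.1 p.2)) (f : L2Seg B) (ξ : ℝ) :
    ∫ x in Icc 0 B, K ξ x * f x = inner ℝ (toL2 B (K ξ) (continuous_section hK ξ)) f := by
  rw [L2.inner_def]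
  refine integral_congr_ae ?_
  filter_upwards [(memLp_of_continuous B (continuous_section hK ξ)).coeFn_toLp] with x hx
  simp only [toL2, hx]
  simp [mul_comm]

theorem norm_integral_kernel_le {B C : ℝ} {K : ℝ → ℝ → ℝ}
    (hK : Continuous (fun p : ℝ × ℝ => K p.1 p.2))
    (hC : ∀ ξ x, ξ ∈ Icc 0 B → x ∈ Icc 0 B → |K ξ x| ≤ C) (f : L2Seg B) {ξ : ℝ}
    (hξ : ξ ∈ Icc 0 B) :
    ‖∫ x in Icc 0 B, K ξ x * f x‖ ≤
      (measureUnivNNReal (segMeasure B) : ℝ) ^ ((2 : ENNReal).toReal)⁻¹ * C * ‖f‖ := by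
  rw [integral_kernel_eq_inner hK]
  refine (norm_inner_le_norm _ _).trans (mul_le_mul_of_nonneg_right ?_ (norm_nonneg _))
  refine Lp.norm_le_of_ae_bound ((abs_nonneg _).trans (hC ξ ξ hξ hξ)) ?_
  filter_upwards [(memLp_of_continuous B (continuous_section hK ξ)).coeFn_toLp,
    ae_restrict_mem measurableSet_Icc] with x hx hxm
  rw [toL2, hx]
  exact hC ξ x hξ hxm

theorem memLp_kernel {B C : ℝ} {K : ℝ → ℝ → ℝ}
    (hK : Continuous (fun p : ℝ × ℝ => K p.1 p.2))
    (hC : ∀ ξ x, ξ ∈ Icc 0 B → x ∈ Icc 0 B → |K ξ x| ≤ C) (f : L2Seg B) :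
    MemLp (fun ξ => ∫ x in Icc 0 B, K ξ x * f x) 2 (segMeasure B) := by
  refine MemLp.of_bound ?_
    ((measureUnivNNReal (segMeasure B) : ℝ) ^ ((2 : ENNReal).toReal)⁻¹ * C * ‖f‖) ?_
  · refine StronglyMeasurable.aestronglyMeasurable ?_
    refine StronglyMeasurable.integral_prod_right (f := fun ξ x => K ξ x * f x) ?_
    exact hK.stronglyMeasurable.mul ((Lp.stronglyMeasurable f).comp_measurable measurable_snd)
  · filter_upwards [ae_restrict_mem measurableSet_Icc] with ξ hξ
    exact norm_integral_kernel_le hK hC f hξ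

/-- The bounded operator on `L²[0, B]` given by
`(kernelOp f)(ξ) = ∫_{[0, B]} K(ξ, x) f(x) dx`, for a continuous kernel `K`. -/
def kernelOp (B C : ℝ) (K : ℝ → ℝ → ℝ)
    (hK : Continuous (fun p : ℝ × ℝ => K p.1 p.2))
    (hC : ∀ ξ x, ξ ∈ Icc 0 B → x ∈ Icc 0 B → |K ξ x| ≤ C) : L2Seg B →L[ℝ] L2Seg B :=
  LinearMap.mkContinuous
    { toFun := fun f => (memLp_kernel hK hC f).toLp (fun ξ => ∫ x in Icc 0 B, K ξ x * f x)
      map_add' := by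
        intro f g
        rw [← MemLp.toLp_add]
        congr 1
        funext ξ
        simp only [Pi.add_apply, integral_kernel_eq_inner hK, inner_add_right]
      map_smul' := by
        intro c f
        rw [RingHom.id_apply, ← MemLp.toLp_const_smul]
        congr 1
        funext ξ
        simp only [Pi.smul_apply, integral_kernel_eq_inner hK, inner_smul_right, smul_eq_mul] }
    ((measureUnivNNReal (segMeasure B) : ℝ) ^ ((2 : ENNReal).toReal)⁻¹ *
      ((measureUnivNNReal (segMeasure B) : ℝ) ^ ((2 : ENNReal).toReal)⁻¹ * |C|))
    (by
      intro f
      rw [mul_assoc]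
      refine Lp.norm_le_of_ae_bound (by positivity) ?_
      filter_upwards [(memLp_kernel hK hC f).coeFn_toLp,
        ae_restrict_mem measurableSet_Icc] with ξ h hξ
      simp only [LinearMap.coe_mk, AddHom.coe_mk]
      rw [h]
      refine (norm_integral_kernel_le hK hC f hξ).trans ?_
      gcongr
      exact le_abs_self C)

theorem kernelOp_ae (B C : ℝ) (K : ℝ → ℝ → ℝ)
    (hK : Continuous (fun p : ℝ × ℝ => K p.1 p.2))
    (hC : ∀ ξ x, ξ ∈ Icc 0 B → x ∈ Icc 0 B → |K ξ x| ≤ C) (f : L2Seg B) :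
    kernelOp B C K hK hC f =ᵐ[segMeasure B] fun ξ => ∫ x in Icc 0 B, K ξ x * f x :=
  (memLp_kernel hK hC f).coeFn_toLp

/-- The restricted call operator `γ` on `L²[0, B]`. -/
def callOp (B : ℝ) : L2Seg B →L[ℝ] L2Seg B :=
  kernelOp B |B| theta continuous_theta (abs_theta_le B)

/-- The restricted put operator `γ*` on `L²[0, B]`. -/
def putOp (B : ℝ) : L2Seg B →L[ℝ] L2Seg B :=
  kernelOp B |B| thetaStar continuous_thetaStar (abs_thetaStar_le B)

theorem callOp_ae (B : ℝ) (f : L2Seg B) : callOp B f =ᵐ[segMeasure B] callFun B f :=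
  kernelOp_ae B |B| theta continuous_theta (abs_theta_le B) f

theorem putOp_ae (B : ℝ) (f : L2Seg B) : putOp B f =ᵐ[segMeasure B] putFun B f :=
  kernelOp_ae B |B| thetaStar continuous_thetaStar (abs_thetaStar_le B) f

/-! ### The explicit singular system -/

/-- The positive solutions `u` of `exp(π/2 + kπ + (-1)^k u) = (1 + cos u) / sin u`; the division
is meaningful because `sin u ≠ 0` is part of the condition. -/
def fixedPointSet (k : ℕ) : Set ℝ :=
  {u | 0 < u ∧ Real.sin u ≠ 0 ∧
    Real.exp (Real.pi / 2 + k * Real.pi + (-1) ^ k * u) = (1 + Real.cos u) / Real.sin u}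

/-- `β_k`: the least element of `fixedPointSet k`. -/
def beta (k : ℕ) : ℝ := sInf (fixedPointSet k)

/-- `ρ_k = π/2 + kπ + (-1)^k β_k`. -/
def rho (k : ℕ) : ℝ := Real.pi / 2 + k * Real.pi + (-1) ^ k * beta k

/-- The singular values `λ_k = (B / ρ_k)²`. -/
def lam (B : ℝ) (k : ℕ) : ℝ := (B / rho k) ^ 2

/-- The coefficient `a_{k,1}`. -/
def a1 (B : ℝ) (k : ℕ) : ℝ :=
  1 / Real.sqrt B * ((-1) ^ k / (Real.exp (rho k) + (-1) ^ k))

/-- The coefficient `a_{k,2}`. -/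
def a2 (B : ℝ) (k : ℕ) : ℝ := (-1) ^ k * Real.exp (rho k) * a1 B k

/-- The coefficient `a_{k,3}`. -/
def a3 (B : ℝ) : ℝ := -(1 / Real.sqrt B)

/-- The coefficient `a_{k,4}`. -/
def a4 (B : ℝ) (k : ℕ) : ℝ :=
  1 / Real.sqrt B *
    ((1 - (-1) ^ k * Real.exp (-rho k)) / (1 + (-1) ^ k * Real.exp (-rho k)))

/-- The exponential part `h_{k,1}`. -/
def h1 (B : ℝ) (k : ℕ) (ξ : ℝ) : ℝ :=
  a1 B k * Real.exp (rho k * ξ / B) + a2 B k * Real.exp (-(rho k * ξ / B))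

/-- The trigonometric part `h_{k,2}`. -/
def h2 (B : ℝ) (k : ℕ) (ξ : ℝ) : ℝ :=
  a3 B * Real.cos (rho k * ξ / B) + a4 B k * Real.sin (rho k * ξ / B)

/-- `φ_k = h_{k,1} + h_{k,2}`. -/
def phi (B : ℝ) (k : ℕ) (ξ : ℝ) : ℝ := h1 B k ξ + h2 B k ξ

/-- `ψ_k = h_{k,1} - h_{k,2}`. -/
def psi (B : ℝ) (k : ℕ) (ξ : ℝ) : ℝ := h1 B k ξ - h2 B k ξ

theorem continuous_phi (B : ℝ) (k : ℕ) : Continuous (phi B k) := by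
  unfold phi h1 h2; fun_prop

theorem continuous_psi (B : ℝ) (k : ℕ) : Continuous (psi B k) := by
  unfold psi h1 h2; fun_prop

/-- `φ_k` as an element of `L²[0, B]`. -/
def phiL2 (B : ℝ) (k : ℕ) : L2Seg B := toL2 B (phi B k) (continuous_phi B k)

/-- `ψ_k` as an element of `L²[0, B]`. -/
def psiL2 (B : ℝ) (k : ℕ) : L2Seg B := toL2 B (psi B k) (continuous_psi B k)

/-- `(v_k)` is, without redundancy, a complete orthonormal system of eigenvectors of `T` for the
eigenvalues `(μ_k)`: it is an orthonormal family with dense span, the eigenvalues of `T` are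
exactly the `μ_k`, and the eigenspace of each `μ_k` is the line spanned by `v_k`. -/
structure IsSimpleEigenbasis {E : Type*} [NormedAddCommGroup E] [InnerProductSpace ℝ E]
    (T : E →L[ℝ] E) (μ : ℕ → ℝ) (v : ℕ → E) : Prop where
  orthonormal : Orthonormal ℝ v
  complete : (Submodule.span ℝ (range v)).topologicalClosure = ⊤
  hasEigenvalue_iff : ∀ c : ℝ,
    Module.End.HasEigenvalue (T : E →ₗ[ℝ] E) c ↔ ∃ k, c = μ k
  eigenspace_eq : ∀ k,
    Module.End.eigenspace (T : E →ₗ[ℝ] E) (μ k) = Submodule.span ℝ {v k}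

end RestrictedOptions

end

noncomputable section

namespace RestrictedOptions

/-! ### The roots of the characteristic equation -/

/-! The kernel $(x-\xi)^+$ is the Green function of $d^2/dx^2$ with zero value and slope at $B$, and
its transpose is the one with zero data at $0$. So $\gamma$ and $\gamma^*$ integrate twice, clamping
the right and the left end. An equation $\gamma^*\gamma f=cf$ with $c=\kappa^{-4}$ becomes
$p''=\kappa^2q$, $q''=\kappa^2p$ with $p$ clamped at $0$ and $q$ at $B$: the vibrating cantilever.
Here $p+q$ is hyperbolic and $p-q$ circular, and a nonzero solution exists only if $\cosh(\kappa
B)\cos(\kappa B)=-1$ (`exists_eq_mul_phi`). Substituting $\rho=\pi/2+k\pi+(-1)^ku$ turns this into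
the fixed point equation, so the roots are the $\rho_k$ (`exists_eq_rho`).

Completeness comes from the spectral theorem: $\gamma$ is compact by Arzelà–Ascoli
(`isCompactOperator_callOp`), $\gamma^*\gamma$ is symmetric, and every eigenvector lies in the span
of the $\phi_k$ (`mem_span_phiL2_of_eigen`); the eigenvalue $0$ is excluded because $\gamma$ is
injective. The system $(\psi_k)$ inherits completeness through the injectivity of $\gamma^*$. The
norms are $1$ because $\|\phi_k\|^2+\|\psi_k\|^2=2$ by an explicit primitive, while adjointness
makes the two terms equal. -/

theorem half_pi_add_pos (k : ℕ) {u : ℝ} (hu : u ∈ Ioc 0 (Real.pi / 2)) :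
    0 < Real.pi / 2 + k * Real.pi + (-1) ^ k * u := by
  have hπ := Real.pi_pos
  obtain ⟨h0, h1⟩ := hu
  rcases Nat.eq_zero_or_pos k with rfl | hk
  · simp; linarith
  · have : Real.pi ≤ k * Real.pi := by
      have : (1 : ℝ) ≤ k := by exact_mod_cast hk
      nlinarith
    rcases neg_one_pow_eq_or ℝ k with h | h <;> rw [h] <;> linarith

/-- Intermediate value theorem for the equation with the denominator cleared: the difference is $-2$
at $0$ and positive at $\pi/2$. -/
theorem exists_mem_fixedPointSet (k : ℕ) : ∃ u ∈ fixedPointSet k, u < Real.pi / 2 := by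
  have hπ := Real.pi_pos
  let H : ℝ → ℝ := fun u =>
    Real.exp (Real.pi / 2 + k * Real.pi + (-1) ^ k * u) * Real.sin u - (1 + Real.cos u)
  have hc : ContinuousOn H (Icc 0 (Real.pi / 2)) := by
    apply Continuous.continuousOn
    fun_prop
  have h0 : H 0 < 0 := by simp [H]
  have h1 : 0 < H (Real.pi / 2) := by
    simpa [H] using half_pi_add_pos k (u := Real.pi / 2) ⟨by positivity, le_rfl⟩
  obtain ⟨u, ⟨hu0, hu1⟩, hu⟩ := intermediate_value_Ioo (by positivity) hc ⟨h0, h1⟩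
  have hs : 0 < Real.sin u := Real.sin_pos_of_pos_of_lt_pi hu0 (by linarith)
  refine ⟨u, ⟨hu0, hs.ne', ?_⟩, hu1⟩
  rw [eq_div_iff hs.ne']
  simpa [H, sub_eq_zero] using hu

/-- This is the logarithm of the fixed point equation. The derivative is $-1/\sin u-(-1)^k$,
negative for either parity since $\sin u<1$. -/
theorem strictAntiOn_log_aux (k : ℕ) :
    StrictAntiOn (fun u : ℝ => Real.log (1 + Real.cos u) - Real.log (Real.sin u) - (-1) ^ k * u)
      (Ioo 0 (Real.pi / 2)) := by
  have hπ := Real.pi_pos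
  have key : ∀ u ∈ Ioo 0 (Real.pi / 2), HasDerivAt
      (fun u : ℝ => Real.log (1 + Real.cos u) - Real.log (Real.sin u) - (-1) ^ k * u)
      (-Real.sin u / (1 + Real.cos u) - Real.cos u / Real.sin u - (-1) ^ k * 1) u := by
    intro u hu
    have hs : 0 < Real.sin u := Real.sin_pos_of_pos_of_lt_pi hu.1 (by linarith [hu.2])
    have hc : 0 < Real.cos u := Real.cos_pos_of_mem_Ioo ⟨by linarith [hu.1], hu.2⟩
    exact ((((Real.hasDerivAt_cos u).const_add 1).log (by positivity)).sub
      ((Real.hasDerivAt_sin u).log hs.ne')).sub ((hasDerivAt_id u).const_mul _)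
  refine strictAntiOn_of_deriv_neg (convex_Ioo _ _)
    (fun u hu => (key u hu).continuousAt.continuousWithinAt) ?_
  rw [interior_Ioo]
  intro u hu
  have hs : 0 < Real.sin u := Real.sin_pos_of_pos_of_lt_pi hu.1 (by linarith [hu.2])
  have hc : 0 < Real.cos u := Real.cos_pos_of_mem_Ioo ⟨by linarith [hu.1], hu.2⟩
  have hsc := Real.sin_sq_add_cos_sq u
  rw [(key u hu).deriv]
  have h1 : -Real.sin u / (1 + Real.cos u) - Real.cos u / Real.sin u = -(1 / Real.sin u) := by
    field_simp
    nlinarith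
  have h2 : 1 < 1 / Real.sin u := by
    rw [lt_div_iff₀ hs]
    nlinarith
  rw [h1]
  rcases neg_one_pow_eq_or ℝ k with h | h <;> rw [h] <;> linarith

theorem fixedPointSet_unique (k : ℕ) {u v : ℝ} (hu : u ∈ fixedPointSet k)
    (hv : v ∈ fixedPointSet k) (hu' : u < Real.pi / 2) (hv' : v < Real.pi / 2) : u = v := by
  have hπ := Real.pi_pos
  have key : ∀ w ∈ fixedPointSet k, w < Real.pi / 2 →
      Real.log (1 + Real.cos w) - Real.log (Real.sin w) - (-1) ^ k * w =
        Real.pi / 2 + k * Real.pi := by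
    rintro w ⟨h0, hs, h⟩ hw
    have hc : 0 < Real.cos w := Real.cos_pos_of_mem_Ioo ⟨by linarith, hw⟩
    rw [← Real.log_div (by positivity) hs, ← h, Real.log_exp]
    ring
  exact (strictAntiOn_log_aux k).injOn ⟨hu.1, hu'⟩ ⟨hv.1, hv'⟩
    ((key u hu hu').trans (key v hv hv').symm)

/-- A solution below the one found in $(0,\pi/2)$ would lie in the same interval, contradicting
uniqueness there; so the infimum is attained. -/
theorem isLeast_beta_and_lt (k : ℕ) :
    IsLeast (fixedPointSet k) (beta k) ∧ beta k < Real.pi / 2 := by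
  obtain ⟨u, hu, hu'⟩ := exists_mem_fixedPointSet k
  have hl : IsLeast (fixedPointSet k) u := by
    refine ⟨hu, fun v hv => ?_⟩
    by_contra! h
    exact h.ne (fixedPointSet_unique k hv hu (h.trans hu') hu')
  have : beta k = u := hl.csInf_eq
  rw [this]
  exact ⟨hl, hu'⟩

theorem isLeast_beta (k : ℕ) : IsLeast (fixedPointSet k) (beta k) := (isLeast_beta_and_lt k).1

theorem beta_mem_Ioo (k : ℕ) : beta k ∈ Ioo 0 (Real.pi / 2) :=
  ⟨(isLeast_beta k).1.1, (isLeast_beta_and_lt k).2⟩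

theorem rho_pos (k : ℕ) : 0 < rho k :=
  half_pi_add_pos k ⟨(beta_mem_Ioo k).1, (beta_mem_Ioo k).2.le⟩

theorem rho_mem_Ioo (k : ℕ) : rho k ∈ Ioo (k * Real.pi) ((k + 1) * Real.pi) := by
  obtain ⟨h0, h1⟩ := beta_mem_Ioo k
  unfold rho
  rcases neg_one_pow_eq_or ℝ k with h | h <;> rw [h] <;> constructor <;> linarith

theorem strictMono_rho : StrictMono rho := by
  refine strictMono_nat_of_lt_succ fun k => (rho_mem_Ioo k).2.trans ?_
  have := (rho_mem_Ioo (k + 1)).1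
  push_cast at this
  exact this

theorem lam_pos {B : ℝ} (hB : 0 < B) (k : ℕ) : 0 < lam B k := by
  have := rho_pos k
  unfold lam
  positivity

theorem strictAnti_lam {B : ℝ} (hB : 0 < B) : StrictAnti (lam B) := by
  intro j k h
  have hj := rho_pos j
  have hk := rho_pos k
  have := strictMono_rho h
  unfold lam
  gcongr

/-- The hyperbolic and circular functions of `ρ_k` in terms of `c = cos β_k`, `s = sin β_k`. -/
theorem rho_values (k : ℕ) : ∃ c s : ℝ, 0 < c ∧ 0 < s ∧ s ^ 2 + c ^ 2 = 1 ∧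
    Real.exp (rho k) = (1 + c) / s ∧ Real.cosh (rho k) = 1 / s ∧ Real.sinh (rho k) = c / s ∧
    Real.cos (rho k) = -s ∧ Real.sin (rho k) = (-1) ^ k * c := by
  have hπ := Real.pi_pos
  obtain ⟨h0, h1⟩ := beta_mem_Ioo k
  have hs : 0 < Real.sin (beta k) := Real.sin_pos_of_pos_of_lt_pi h0 (by linarith)
  have hc : 0 < Real.cos (beta k) := Real.cos_pos_of_mem_Ioo ⟨by linarith, h1⟩
  have hsc := Real.sin_sq_add_cos_sq (beta k)
  have he : Real.exp (rho k) = (1 + Real.cos (beta k)) / Real.sin (beta k) :=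
    (isLeast_beta k).1.2.2
  have he' : Real.exp (-rho k) = (1 - Real.cos (beta k)) / Real.sin (beta k) := by
    rw [Real.exp_neg, he]
    field_simp
    nlinarith
  have hr : rho k = (-1) ^ k * beta k + Real.pi / 2 + k * Real.pi := by unfold rho; ring
  refine ⟨_, _, hc, hs, hsc, he, ?_, ?_, ?_, ?_⟩
  · rw [Real.cosh_eq, he, he']; field_simp; ring
  · rw [Real.sinh_eq, he, he']; field_simp; ring
  · rw [hr, Real.cos_add_nat_mul_pi, Real.cos_add_pi_div_two]
    rcases neg_one_pow_eq_or ℝ k with h | h <;> rw [h] <;> simp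
  · rw [hr, Real.sin_add_nat_mul_pi, Real.sin_add_pi_div_two]
    rcases neg_one_pow_eq_or ℝ k with h | h <;> rw [h] <;> simp

/-- The `ρ_k` are the only positive roots of `cosh ρ cos ρ = -1`. -/
theorem exists_eq_rho {ρ : ℝ} (hρ : 0 < ρ) (h : Real.cosh ρ * Real.cos ρ = -1) :
    ∃ k, ρ = rho k := by
  have hπ := Real.pi_pos
  -- The index is forced by $\rho_k\in(k\pi,(k+1)\pi)$; $u$ below is then obtained by solving
  -- $\rho=\pi/2+k\pi+(-1)^ku$.
  set k := ⌊ρ / Real.pi⌋₊ with hk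
  have hk0 : k * Real.pi ≤ ρ := by
    rw [← le_div_iff₀ hπ]; exact Nat.floor_le (by positivity)
  have hk1 : ρ < (k + 1) * Real.pi := by
    rw [← div_lt_iff₀ hπ]; exact Nat.lt_floor_add_one _
  have hε : ((-1 : ℝ) ^ k) ^ 2 = 1 := by rw [← pow_mul, mul_comm, pow_mul]; simp
  set u := (-1) ^ k * (ρ - Real.pi / 2 - k * Real.pi) with hu
  have hr : ρ = Real.pi / 2 + k * Real.pi + (-1) ^ k * u := by
    rw [hu, ← mul_assoc, ← sq, hε]; ring
  have hcos : Real.cos ρ = -Real.sin u := by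
    have : ρ = (-1) ^ k * u + Real.pi / 2 + k * Real.pi := by rw [hr]; ring
    rw [this, Real.cos_add_nat_mul_pi, Real.cos_add_pi_div_two]
    rcases neg_one_pow_eq_or ℝ k with h | h <;> rw [h] <;> simp
  have hch : 0 < Real.cosh ρ := Real.cosh_pos ρ
  have hsh : 0 < Real.sinh ρ := Real.sinh_pos_iff.2 hρ
  have hcs : Real.cosh ρ * Real.sin u = 1 := by rw [hcos] at h; linarith
  have hs : 0 < Real.sin u := by
    by_contra! hs
    nlinarith
  have hub : -(Real.pi / 2) ≤ u ∧ u ≤ Real.pi / 2 := by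
    rw [hu]
    rcases neg_one_pow_eq_or ℝ k with h | h <;> rw [h] <;> constructor <;> linarith
  have hu0 : 0 < u := by
    by_contra! hn
    exact absurd (Real.sin_nonpos_of_nonpos_of_neg_pi_le hn (by linarith)) (not_le.2 hs)
  have hu1 : u < Real.pi / 2 := by
    refine lt_of_le_of_ne hub.2 fun he => ?_
    rw [he, Real.sin_pi_div_two, mul_one] at hcs
    nlinarith [Real.cosh_sq ρ]
  have hc : 0 < Real.cos u := Real.cos_pos_of_mem_Ioo ⟨by linarith, hu1⟩
  -- Together with $\cosh\rho\sin u=1$ this gives $e^\rho\sin u=1+\cos u$. The squares agree by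
  -- $\cosh^2-\sinh^2=1$, and both sides are positive.
  have hexp : Real.sinh ρ * Real.sin u = Real.cos u := by
    have h1 : (Real.sinh ρ * Real.sin u) ^ 2 = Real.cos u ^ 2 := by
      have := Real.cosh_sq ρ
      have h2 := Real.sin_sq_add_cos_sq u
      have h3 : (Real.cosh ρ * Real.sin u) ^ 2 = 1 := by rw [hcs]; ring
      rw [mul_pow] at h3 ⊢
      rw [this] at h3
      linarith
    exact (pow_left_inj₀ (by positivity) hc.le two_ne_zero).1 h1
  have hmem : u ∈ fixedPointSet k := by
    refine ⟨hu0, hs.ne', ?_⟩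
    rw [← hr, eq_div_iff hs.ne', ← Real.cosh_add_sinh, add_mul, hcs, hexp]
  have : u = beta k :=
    fixedPointSet_unique k hmem (isLeast_beta k).1 hu1 (beta_mem_Ioo k).2
  exact ⟨k, by rw [hr, this]; rfl⟩

/-! ### The singular functions in hyperbolic form -/

/-- The quotient of the odd and the even coefficients of `φ_k`. -/
def slope (k : ℕ) : ℝ := (Real.exp (rho k) - (-1) ^ k) / (Real.exp (rho k) + (-1) ^ k)

theorem exp_rho_add_pos (k : ℕ) : 0 < Real.exp (rho k) + (-1) ^ k := by
  have := Real.one_lt_exp_iff.2 (rho_pos k)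
  rcases neg_one_pow_eq_or ℝ k with h | h <;> rw [h] <;> linarith

theorem neg_one_pow_sq (k : ℕ) : ((-1 : ℝ) ^ k) ^ 2 = 1 := by
  rw [← pow_mul, mul_comm, pow_mul]; simp

theorem one_add_exp_neg_rho (k : ℕ) : 1 + (-1) ^ k * Real.exp (-rho k) =
    (Real.exp (rho k) + (-1) ^ k) / Real.exp (rho k) := by
  rw [Real.exp_neg]
  field_simp

theorem a2_eq (B : ℝ) (k : ℕ) :
    a2 B k = 1 / Real.sqrt B * (1 / (1 + (-1) ^ k * Real.exp (-rho k))) := by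
  have h := (exp_rho_add_pos k).ne'
  have hε := neg_one_pow_sq k
  rw [one_add_exp_neg_rho, one_div_div, a2, a1]
  linear_combination 1 / Real.sqrt B * (Real.exp (rho k) / (Real.exp (rho k) + (-1) ^ k)) * hε

theorem a4_eq (B : ℝ) (k : ℕ) : a4 B k = 1 / Real.sqrt B * slope k := by
  have h := (exp_rho_add_pos k).ne'
  have : 1 - (-1) ^ k * Real.exp (-rho k) =
    (Real.exp (rho k) - (-1) ^ k) / Real.exp (rho k) := by
    rw [Real.exp_neg]
    field_simp
  rw [a4, one_add_exp_neg_rho, this, div_div_div_cancel_right₀ (Real.exp_pos _).ne', slope]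

theorem a1_eq (B : ℝ) (k : ℕ) : a1 B k = 1 / Real.sqrt B * ((1 - slope k) / 2) := by
  have h := (exp_rho_add_pos k).ne'
  rw [a1, slope]
  congr 1
  field_simp
  ring

theorem a2_eq_slope (B : ℝ) (k : ℕ) : a2 B k = 1 / Real.sqrt B * ((1 + slope k) / 2) := by
  have h := (exp_rho_add_pos k).ne'
  rw [a2_eq, one_add_exp_neg_rho, slope]
  congr 1
  field_simp
  ring

/-- The hyperbolic and circular parts of $\psi_k$ and of its derivative at $B$. Adding the first to
the third and the second to the fourth gives the clamping at $B$; separately, they are the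
coefficients in the addition formulas behind the reflection symmetry. -/
theorem slope_values (k : ℕ) :
    Real.cosh (rho k) - slope k * Real.sinh (rho k) = (-1) ^ k ∧
    slope k * Real.cosh (rho k) - Real.sinh (rho k) = -((-1) ^ k * slope k) ∧
    Real.cos (rho k) - slope k * Real.sin (rho k) = -(-1) ^ k ∧
    Real.sin (rho k) + slope k * Real.cos (rho k) = (-1) ^ k * slope k := by
  obtain ⟨c, s, hc, hs, hsc, he, hch, hsh, hcos, hsin⟩ := rho_values k
  have hpos := exp_rho_add_pos k
  have hε := neg_one_pow_sq k
  set ε : ℝ := (-1) ^ k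
  have ht : slope k = (1 - ε * s) / c := by
    change (Real.exp (rho k) - ε) / (Real.exp (rho k) + ε) = _
    rw [div_eq_div_iff hpos.ne' hc.ne', he]
    field_simp
    linear_combination hsc + s ^ 2 * hε
  rw [hch, hsh, hcos, hsin, ht]
  have hc2 : c ^ 2 = 1 - s ^ 2 := by linarith
  refine ⟨?_, ?_, ?_, ?_⟩
  · field_simp; ring
  · field_simp
    rw [hc2]
    linear_combination -s ^ 2 * hε
  · field_simp
    linear_combination s * hε
  · field_simp
    rw [hc2]
    linear_combination s * hε

/-- The oscillating part at $B$ of the primitive of $\phi_k^2+\psi_k^2$. With $t$ the slope, the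
hyperbolic half equals $2t$ and the circular half $-2t$. -/
theorem slope_energy (k : ℕ) :
    (1 + slope k ^ 2) * (Real.sinh (rho k) * Real.cosh (rho k)) -
      2 * slope k * Real.sinh (rho k) ^ 2 +
      (1 - slope k ^ 2) * (Real.sin (rho k) * Real.cos (rho k)) -
      2 * slope k * Real.sin (rho k) ^ 2 = 0 := by
  obtain ⟨h1, h2, h3, h4⟩ := slope_values k
  linear_combination -(h1 * (slope k * Real.cosh (rho k) - Real.sinh (rho k)) + (-1) ^ k * h2) +
    slope k * Real.cosh_sq (rho k) + h3 * (Real.sin (rho k) + slope k * Real.cos (rho k)) -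
    (-1) ^ k * h4 - slope k * Real.sin_sq_add_cos_sq (rho k)

/-- With $t$ the slope, $h_{k,1}$ is a multiple of $\cosh-t\sinh$ and $h_{k,2}$ of $-(\cos-t\sin)$.
In this form the clamping at $0$ is immediate. -/
theorem phi_eq (B : ℝ) (k : ℕ) (ξ : ℝ) : phi B k ξ = 1 / Real.sqrt B *
    (Real.cosh (rho k / B * ξ) - Real.cos (rho k / B * ξ) -
      slope k * (Real.sinh (rho k / B * ξ) - Real.sin (rho k / B * ξ))) := by
  rw [phi, h1, h2, a1_eq, a2_eq_slope, a3, a4_eq, Real.cosh_eq, Real.sinh_eq,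
    mul_div_right_comm]
  ring

theorem psi_eq (B : ℝ) (k : ℕ) (ξ : ℝ) : psi B k ξ = 1 / Real.sqrt B *
    (Real.cosh (rho k / B * ξ) + Real.cos (rho k / B * ξ) -
      slope k * (Real.sinh (rho k / B * ξ) + Real.sin (rho k / B * ξ))) := by
  rw [psi, h1, h2, a1_eq, a2_eq_slope, a3, a4_eq, Real.cosh_eq, Real.sinh_eq,
    mul_div_right_comm]
  ring

/-- The derivative of `φ_k`. -/
def dphi (B : ℝ) (k : ℕ) (ξ : ℝ) : ℝ := 1 / Real.sqrt B * (rho k / B *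
    (Real.sinh (rho k / B * ξ) + Real.sin (rho k / B * ξ) -
      slope k * (Real.cosh (rho k / B * ξ) - Real.cos (rho k / B * ξ))))

/-- The derivative of `ψ_k`. -/
def dpsi (B : ℝ) (k : ℕ) (ξ : ℝ) : ℝ := 1 / Real.sqrt B * (rho k / B *
    (Real.sinh (rho k / B * ξ) - Real.sin (rho k / B * ξ) -
      slope k * (Real.cosh (rho k / B * ξ) + Real.cos (rho k / B * ξ))))

section
variable (κ ξ : ℝ)

theorem hasDerivAt_cosh_mul : HasDerivAt (fun x => Real.cosh (κ * x)) (κ * Real.sinh (κ * ξ)) ξ := by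
  simpa [mul_comm] using ((hasDerivAt_id ξ).const_mul κ).cosh

theorem hasDerivAt_sinh_mul : HasDerivAt (fun x => Real.sinh (κ * x)) (κ * Real.cosh (κ * ξ)) ξ := by
  simpa [mul_comm] using ((hasDerivAt_id ξ).const_mul κ).sinh

theorem hasDerivAt_cos_mul : HasDerivAt (fun x => Real.cos (κ * x)) (-(κ * Real.sin (κ * ξ))) ξ := by
  simpa [mul_comm] using ((hasDerivAt_id ξ).const_mul κ).cos

theorem hasDerivAt_sin_mul : HasDerivAt (fun x => Real.sin (κ * x)) (κ * Real.cos (κ * ξ)) ξ := by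
  simpa [mul_comm] using ((hasDerivAt_id ξ).const_mul κ).sin

end

theorem hasDerivAt_phi (B : ℝ) (k : ℕ) (ξ : ℝ) : HasDerivAt (phi B k) (dphi B k ξ) ξ := by
  rw [funext (phi_eq B k), dphi]
  convert! (((hasDerivAt_cosh_mul (rho k / B) ξ).sub (hasDerivAt_cos_mul (rho k / B) ξ)).sub
    (((hasDerivAt_sinh_mul (rho k / B) ξ).sub (hasDerivAt_sin_mul (rho k / B) ξ)).const_mul
      (slope k))).const_mul (1 / Real.sqrt B) using 1
  ring

theorem hasDerivAt_psi (B : ℝ) (k : ℕ) (ξ : ℝ) : HasDerivAt (psi B k) (dpsi B k ξ) ξ := by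
  rw [funext (psi_eq B k), dpsi]
  convert! (((hasDerivAt_cosh_mul (rho k / B) ξ).add (hasDerivAt_cos_mul (rho k / B) ξ)).sub
    (((hasDerivAt_sinh_mul (rho k / B) ξ).add (hasDerivAt_sin_mul (rho k / B) ξ)).const_mul
      (slope k))).const_mul (1 / Real.sqrt B) using 1
  ring

theorem hasDerivAt_dphi (B : ℝ) (k : ℕ) (ξ : ℝ) :
    HasDerivAt (dphi B k) ((rho k / B) ^ 2 * psi B k ξ) ξ := by
  rw [psi_eq]
  convert! ((((hasDerivAt_sinh_mul (rho k / B) ξ).add (hasDerivAt_sin_mul (rho k / B) ξ)).sub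
    (((hasDerivAt_cosh_mul (rho k / B) ξ).sub (hasDerivAt_cos_mul (rho k / B) ξ)).const_mul
      (slope k))).const_mul (rho k / B)).const_mul (1 / Real.sqrt B) using 1
  ring

theorem hasDerivAt_dpsi (B : ℝ) (k : ℕ) (ξ : ℝ) :
    HasDerivAt (dpsi B k) ((rho k / B) ^ 2 * phi B k ξ) ξ := by
  rw [phi_eq]
  convert! ((((hasDerivAt_sinh_mul (rho k / B) ξ).sub (hasDerivAt_sin_mul (rho k / B) ξ)).sub
    (((hasDerivAt_cosh_mul (rho k / B) ξ).add (hasDerivAt_cos_mul (rho k / B) ξ)).const_mul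
      (slope k))).const_mul (rho k / B)).const_mul (1 / Real.sqrt B) using 1
  ring

theorem phi_zero (B : ℝ) (k : ℕ) : phi B k 0 = 0 := by simp [phi_eq]

theorem dphi_zero (B : ℝ) (k : ℕ) : dphi B k 0 = 0 := by simp [dphi]

theorem psi_end {B : ℝ} (hB : 0 < B) (k : ℕ) : psi B k B = 0 := by
  obtain ⟨h1, -, h3, -⟩ := slope_values k
  rw [psi_eq, div_mul_cancel₀ _ hB.ne']
  linear_combination 1 / Real.sqrt B * (h1 + h3)

theorem dpsi_end {B : ℝ} (hB : 0 < B) (k : ℕ) : dpsi B k B = 0 := by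
  obtain ⟨-, h2, -, h4⟩ := slope_values k
  rw [dpsi, div_mul_cancel₀ _ hB.ne']
  linear_combination -(1 / Real.sqrt B * (rho k / B)) * (h2 + h4)

theorem psi_reflect {B : ℝ} (hB : 0 < B) (k : ℕ) (ξ : ℝ) :
    psi B k (B - ξ) = (-1) ^ k * phi B k ξ := by
  obtain ⟨h1, h2, h3, h4⟩ := slope_values k
  rw [psi_eq, phi_eq, mul_sub (rho k / B), div_mul_cancel₀ _ hB.ne', Real.cosh_sub, Real.sinh_sub,
    Real.cos_sub, Real.sin_sub]
  linear_combination 1 / Real.sqrt B * (Real.cosh (rho k / B * ξ) * h1 +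
    Real.sinh (rho k / B * ξ) * h2 + Real.cos (rho k / B * ξ) * h3 +
    Real.sin (rho k / B * ξ) * h4)

theorem phi_reflect {B : ℝ} (hB : 0 < B) (k : ℕ) (ξ : ℝ) :
    phi B k (B - ξ) = (-1) ^ k * psi B k ξ := by
  have h := psi_reflect hB k (B - ξ)
  rw [sub_sub_cancel] at h
  rw [h]
  linear_combination -phi B k (B - ξ) * neg_one_pow_sq k

/-- The functions `φ_k` and `ψ_k` have total energy two. -/
theorem integral_phi_sq_add_psi_sq {B : ℝ} (hB : 0 < B) (k : ℕ) :
    ∫ x in 0..B, (phi B k x ^ 2 + psi B k x ^ 2) = 2 := by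
  have hρ := (rho_pos k).ne'
  set κ := rho k / B with hκ
  have hκ0 : κ ≠ 0 := div_ne_zero hρ hB.ne'
  set t := slope k with ht
  -- The integrand is $\frac2B\big((\cosh-t\sinh)^2+(\cos-t\sin)^2\big)$. In its primitive the
  -- linear terms in $t^2$ cancel and leave $x$; the bracket vanishes at $0$ and, by `slope_energy`,
  -- at $B$.
  have hd : ∀ x ∈ uIcc 0 B, HasDerivAt (fun x => 2 / B * (x + 1 / (2 * κ) *
      ((1 + t ^ 2) * (Real.sinh (κ * x) * Real.cosh (κ * x)) - 2 * t * Real.sinh (κ * x) ^ 2 +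
      (1 - t ^ 2) * (Real.sin (κ * x) * Real.cos (κ * x)) - 2 * t * Real.sin (κ * x) ^ 2)))
      (phi B k x ^ 2 + psi B k x ^ 2) x := by
    intro x _
    have e1 := hasDerivAt_sinh_mul κ x
    have e2 := hasDerivAt_cosh_mul κ x
    have e3 := hasDerivAt_sin_mul κ x
    have e4 := hasDerivAt_cos_mul κ x
    convert! ((hasDerivAt_id x).add (((((e1.mul e2).const_mul (1 + t ^ 2)).sub
      ((e1.pow 2).const_mul (2 * t))).add ((e3.mul e4).const_mul (1 - t ^ 2))).sub
      ((e3.pow 2).const_mul (2 * t)) |>.const_mul (1 / (2 * κ)))).const_mul (2 / B) using 1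
    rw [phi_eq, psi_eq, ← hκ, ← ht]
    have hc := Real.cosh_sq (κ * x)
    have hs := Real.sin_sq_add_cos_sq (κ * x)
    have hBs : (1 / Real.sqrt B) ^ 2 = 1 / B := by rw [div_pow, Real.sq_sqrt hB.le]; simp
    rw [mul_pow, mul_pow, hBs]
    field_simp
    linear_combination (1 - t ^ 2) * hc + (1 + t ^ 2) * hs
  rw [intervalIntegral.integral_eq_sub_of_hasDerivAt hd]
  · simp only [hκ, ht, div_mul_cancel₀ _ hB.ne', mul_zero, Real.sinh_zero, Real.sin_zero,
      slope_energy]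
    field_simp
    ring
  · exact (((continuous_phi B k).pow 2).add ((continuous_psi B k).pow 2)).intervalIntegrable _ _

/-! ### The integral operators on continuous functions -/

/-- Integration by parts, that is, Taylor's formula at $B$ with integral remainder: $\gamma g$ is a
second primitive of $g$ minus its tangent line at $B$. -/
theorem callFun_eq_of_hasDerivAt {B : ℝ} {u u' g : ℝ → ℝ} (hu : ∀ x, HasDerivAt u (u' x) x)
    (hu' : ∀ x, HasDerivAt u' (g x) x) (hg : Continuous g) {ξ : ℝ} (hξ : ξ ∈ Icc 0 B) :
    callFun B g ξ = u ξ - u B - (ξ - B) * u' B := by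
  have hc : Continuous fun x => theta ξ x * g x :=
    (continuous_section continuous_theta ξ).mul hg
  have hi : ∀ a b, IntervalIntegrable (fun x => theta ξ x * g x) volume a b :=
    fun a b => hc.intervalIntegrable a b
  rw [callFun, integral_Icc_eq_integral_Ioc,
    ← intervalIntegral.integral_of_le (hξ.1.trans hξ.2),
    ← intervalIntegral.integral_add_adjacent_intervals (hi 0 ξ) (hi ξ B)]
  have e1 : ∫ x in 0..ξ, theta ξ x * g x = 0 := by
    refine (intervalIntegral.integral_congr (g := fun _ => 0) fun x hx => ?_).trans (by simp)
    rw [uIcc_of_le hξ.1] at hx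
    simp [theta, hx.2]
  have e2 : ∫ x in ξ..B, theta ξ x * g x = ∫ x in ξ..B, (x - ξ) * g x := by
    refine intervalIntegral.integral_congr fun x hx => ?_
    rw [uIcc_of_le hξ.2] at hx
    simp [theta, hx.1]
  have e3 : ∀ x ∈ uIcc ξ B, HasDerivAt (fun x => (x - ξ) * u' x - u x) ((x - ξ) * g x) x := by
    intro x _
    convert! (((hasDerivAt_id x).sub_const ξ).mul (hu' x)).sub (hu x) using 1
    simp
  rw [e1, e2, intervalIntegral.integral_eq_sub_of_hasDerivAt e3
    ((by fun_prop : Continuous fun x => (x - ξ) * g x).intervalIntegrable _ _)]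
  ring

theorem putFun_eq_of_hasDerivAt {B : ℝ} {u u' g : ℝ → ℝ} (hu : ∀ x, HasDerivAt u (u' x) x)
    (hu' : ∀ x, HasDerivAt u' (g x) x) (hg : Continuous g) {ξ : ℝ} (hξ : ξ ∈ Icc 0 B) :
    putFun B g ξ = u ξ - u 0 - ξ * u' 0 := by
  have hc : Continuous fun x => thetaStar ξ x * g x :=
    (continuous_section continuous_thetaStar ξ).mul hg
  have hi : ∀ a b, IntervalIntegrable (fun x => thetaStar ξ x * g x) volume a b :=
    fun a b => hc.intervalIntegrable a b
  rw [putFun, integral_Icc_eq_integral_Ioc,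
    ← intervalIntegral.integral_of_le (hξ.1.trans hξ.2),
    ← intervalIntegral.integral_add_adjacent_intervals (hi 0 ξ) (hi ξ B)]
  have e1 : ∫ x in ξ..B, thetaStar ξ x * g x = 0 := by
    refine (intervalIntegral.integral_congr (g := fun _ => 0) fun x hx => ?_).trans (by simp)
    rw [uIcc_of_le hξ.2] at hx
    simp [thetaStar, theta, hx.1]
  have e2 : ∫ x in 0..ξ, thetaStar ξ x * g x = ∫ x in 0..ξ, (ξ - x) * g x := by
    refine intervalIntegral.integral_congr fun x hx => ?_
    rw [uIcc_of_le hξ.1] at hx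
    simp [thetaStar, theta, hx.2]
  have e3 : ∀ x ∈ uIcc 0 ξ, HasDerivAt (fun x => (ξ - x) * u' x + u x) ((ξ - x) * g x) x := by
    intro x _
    convert! (((hasDerivAt_id x).const_sub ξ).mul (hu' x)).add (hu x) using 1
    simp
  rw [e1, e2, intervalIntegral.integral_eq_sub_of_hasDerivAt e3
    ((by fun_prop : Continuous fun x => (ξ - x) * g x).intervalIntegrable _ _)]
  ring

theorem exists_double_primitive {g : ℝ → ℝ} (hg : Continuous g) :
    ∃ u u' : ℝ → ℝ, (∀ x, HasDerivAt u (u' x) x) ∧ ∀ x, HasDerivAt u' (g x) x := by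
  have h1 : ∀ x, HasDerivAt (fun y => ∫ z in 0..y, g z) (g x) x := fun x =>
    hg.integral_hasStrictDerivAt 0 x |>.hasDerivAt
  have hc : Continuous fun y => ∫ z in 0..y, g z :=
    continuous_iff_continuousAt.2 fun x => (h1 x).continuousAt
  exact ⟨_, _, fun x => (hc.integral_hasStrictDerivAt 0 x).hasDerivAt, h1⟩

theorem lam_mul_sq {B : ℝ} (hB : 0 < B) (k : ℕ) : lam B k * (rho k / B) ^ 2 = 1 := by
  have := rho_pos k
  rw [lam]
  field_simp

theorem hasDerivAt_lam_mul_dpsi {B : ℝ} (hB : 0 < B) (k : ℕ) (x : ℝ) :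
    HasDerivAt (fun x => lam B k * dpsi B k x) (phi B k x) x := by
  convert! (hasDerivAt_dpsi B k x).const_mul (lam B k) using 1
  rw [← mul_assoc, lam_mul_sq hB, one_mul]

theorem hasDerivAt_lam_mul_dphi {B : ℝ} (hB : 0 < B) (k : ℕ) (x : ℝ) :
    HasDerivAt (fun x => lam B k * dphi B k x) (psi B k x) x := by
  convert! (hasDerivAt_dphi B k x).const_mul (lam B k) using 1
  rw [← mul_assoc, lam_mul_sq hB, one_mul]

theorem callFun_phi {B : ℝ} (hB : 0 < B) (k : ℕ) {ξ : ℝ} (hξ : ξ ∈ Icc 0 B) :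
    callFun B (phi B k) ξ = lam B k * psi B k ξ := by
  rw [callFun_eq_of_hasDerivAt (fun x => (hasDerivAt_psi B k x).const_mul (lam B k))
    (hasDerivAt_lam_mul_dpsi hB k) (continuous_phi B k) hξ, psi_end hB, dpsi_end hB]
  ring

theorem putFun_psi {B : ℝ} (hB : 0 < B) (k : ℕ) {ξ : ℝ} (hξ : ξ ∈ Icc 0 B) :
    putFun B (psi B k) ξ = lam B k * phi B k ξ := by
  rw [putFun_eq_of_hasDerivAt (fun x => (hasDerivAt_phi B k x).const_mul (lam B k))
    (hasDerivAt_lam_mul_dphi hB k) (continuous_psi B k) hξ, phi_zero, dphi_zero]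
  ring

theorem contDiff_phi (B : ℝ) (k : ℕ) : ContDiff ℝ 2 (phi B k) := by
  unfold phi h1 h2; fun_prop

theorem contDiff_psi (B : ℝ) (k : ℕ) : ContDiff ℝ 2 (psi B k) := by
  unfold psi h1 h2; fun_prop

theorem iteratedDerivWithin_two_eq {B : ℝ} (hB : 0 < B) {u u' g : ℝ → ℝ} (hc : ContDiff ℝ 2 u)
    (hu : ∀ x, HasDerivAt u (u' x) x) (hu' : ∀ x, HasDerivAt u' (g x) x) {ξ : ℝ}
    (hξ : ξ ∈ Icc 0 B) : iteratedDerivWithin 2 u (Icc 0 B) ξ = g ξ := by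
  rw [iteratedDerivWithin_eq_iteratedDeriv (uniqueDiffOn_Icc hB) hc.contDiffAt hξ,
    iteratedDeriv_succ, iteratedDeriv_one, funext fun x => (hu x).deriv, (hu' ξ).deriv]

/-! ### The operators on `L²[0, B]` -/

theorem toL2_ae (B : ℝ) {f : ℝ → ℝ} (hf : Continuous f) : toL2 B f hf =ᵐ[segMeasure B] f :=
  (memLp_of_continuous B hf).coeFn_toLp

theorem inner_toL2_left (B : ℝ) {g : ℝ → ℝ} (hg : Continuous g) (f : L2Seg B) :
    inner ℝ (toL2 B g hg) f = ∫ x in Icc 0 B, g x * f x := by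
  rw [L2.inner_def]
  refine integral_congr_ae ?_
  filter_upwards [toL2_ae B hg] with x hx
  rw [hx]
  simp [mul_comm]

theorem callFun_congr {B : ℝ} {f g : ℝ → ℝ} (h : f =ᵐ[segMeasure B] g) :
    callFun B f = callFun B g := by
  funext ξ
  refine integral_congr_ae ?_
  filter_upwards [h] with x hx
  rw [hx]

theorem putFun_congr {B : ℝ} {f g : ℝ → ℝ} (h : f =ᵐ[segMeasure B] g) :
    putFun B f = putFun B g := by
  funext ξ
  refine integral_congr_ae ?_
  filter_upwards [h] with x hx
  rw [hx]

theorem ae_of_forall_mem_Icc {B : ℝ} {f g : ℝ → ℝ} (h : ∀ x ∈ Icc 0 B, f x = g x) :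
    f =ᵐ[segMeasure B] g := by
  filter_upwards [ae_restrict_mem measurableSet_Icc] with x hx using h x hx

theorem callOp_toL2 {B : ℝ} {f g : ℝ → ℝ} (hf : Continuous f) (hg : Continuous g)
    (h : ∀ ξ ∈ Icc 0 B, callFun B f ξ = g ξ) : callOp B (toL2 B f hf) = toL2 B g hg := by
  refine Lp.ext ((callOp_ae B _).trans ?_)
  rw [callFun_congr (toL2_ae B hf)]
  exact (ae_of_forall_mem_Icc h).trans (toL2_ae B hg).symm

theorem putOp_toL2 {B : ℝ} {f g : ℝ → ℝ} (hf : Continuous f) (hg : Continuous g)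
    (h : ∀ ξ ∈ Icc 0 B, putFun B f ξ = g ξ) : putOp B (toL2 B f hf) = toL2 B g hg := by
  refine Lp.ext ((putOp_ae B _).trans ?_)
  rw [putFun_congr (toL2_ae B hf)]
  exact (ae_of_forall_mem_Icc h).trans (toL2_ae B hg).symm

theorem toL2_const_mul (B c : ℝ) {f : ℝ → ℝ} (hf : Continuous f) :
    toL2 B (fun x => c * f x) (hf.const_mul c) = c • toL2 B f hf :=
  MemLp.toLp_const_smul c (memLp_of_continuous B hf)

theorem callOp_phiL2 {B : ℝ} (hB : 0 < B) (k : ℕ) :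
    callOp B (phiL2 B k) = lam B k • psiL2 B k := by
  rw [phiL2, psiL2, ← toL2_const_mul]
  exact callOp_toL2 _ _ fun ξ hξ => callFun_phi hB k hξ

theorem putOp_psiL2 {B : ℝ} (hB : 0 < B) (k : ℕ) :
    putOp B (psiL2 B k) = lam B k • phiL2 B k := by
  rw [phiL2, psiL2, ← toL2_const_mul]
  exact putOp_toL2 _ _ fun ξ hξ => putFun_psi hB k hξ

/-- Fubini for the transposed kernel. -/
theorem inner_putOp_left (B : ℝ) (f g : L2Seg B) :
    inner ℝ (putOp B f) g = inner ℝ f (callOp B g) := by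
  have hf : Integrable f (segMeasure B) := (Lp.memLp f).integrable one_le_two
  have hg : Integrable g (segMeasure B) := (Lp.memLp g).integrable one_le_two
  have e1 : inner ℝ (putOp B f) g =
      ∫ ξ in Icc 0 B, ∫ x in Icc 0 B, theta x ξ * (f x * g ξ) := by
    rw [L2.inner_def]
    refine integral_congr_ae ?_
    filter_upwards [putOp_ae B f] with ξ h
    rw [h, RCLike.inner_apply, conj_trivial, putFun, ← integral_const_mul]
    refine integral_congr_ae (ae_of_all _ fun x => ?_)
    simp only [thetaStar]
    ring
  have e2 : inner ℝ f (callOp B g) =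
      ∫ x in Icc 0 B, ∫ ξ in Icc 0 B, theta x ξ * (f x * g ξ) := by
    rw [L2.inner_def]
    refine integral_congr_ae ?_
    filter_upwards [callOp_ae B g] with x h
    rw [h, RCLike.inner_apply, conj_trivial, callFun, mul_comm, ← integral_const_mul]
    refine integral_congr_ae (ae_of_all _ fun ξ => ?_)
    simp only
    ring
  rw [e1, e2]
  refine integral_integral_swap ?_
  -- The product of $f$ and $g$ is integrable because $L^2\subset L^1$ on a finite measure space;
  -- the kernel is bounded only on the square, hence the restricted measure.
  refine Integrable.bdd_mul (c := |B|) (hg.mul_prod hf |>.congr (ae_of_all _ fun p => mul_comm _ _))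
    (continuous_theta.comp continuous_swap).aestronglyMeasurable ?_
  rw [Measure.prod_restrict]
  filter_upwards [ae_restrict_mem (measurableSet_Icc.prod measurableSet_Icc)] with p hp
  exact abs_theta_le B p.2 p.1 hp.2 hp.1

theorem putOp_eq_adjoint (B : ℝ) : putOp B = ContinuousLinearMap.adjoint (callOp B) :=
  (ContinuousLinearMap.eq_adjoint_iff _ _).2 (inner_putOp_left B)

/-- $\lambda\|\phi\|^2=\langle\gamma^*\psi,\phi\rangle=\langle\psi,\gamma\phi\rangle=\lambda\|\psi\|^2$.
-/
theorem norm_phiL2_eq_norm_psiL2 {B : ℝ} (hB : 0 < B) (k : ℕ) : ‖phiL2 B k‖ = ‖psiL2 B k‖ := by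
  have h := inner_putOp_left B (psiL2 B k) (phiL2 B k)
  rw [callOp_phiL2 hB, putOp_psiL2 hB, inner_smul_left, inner_smul_right,
    real_inner_self_eq_norm_sq, real_inner_self_eq_norm_sq] at h
  exact (pow_left_inj₀ (norm_nonneg _) (norm_nonneg _) two_ne_zero).1
    (mul_left_cancel₀ (lam_pos hB k).ne' h)

theorem norm_toL2_sq {B : ℝ} (hB : 0 < B) {f : ℝ → ℝ} (hf : Continuous f) :
    ‖toL2 B f hf‖ ^ 2 = ∫ x in 0..B, f x ^ 2 := by
  rw [← real_inner_self_eq_norm_sq, inner_toL2_left, intervalIntegral.integral_of_le hB.le,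
    ← integral_Icc_eq_integral_Ioc]
  refine integral_congr_ae ?_
  filter_upwards [toL2_ae B hf] with x hx
  rw [hx, sq]

theorem norm_psiL2 {B : ℝ} (hB : 0 < B) (k : ℕ) : ‖psiL2 B k‖ = 1 := by
  have h : ‖phiL2 B k‖ ^ 2 + ‖psiL2 B k‖ ^ 2 = 2 := by
    rw [phiL2, psiL2, norm_toL2_sq hB, norm_toL2_sq hB, ← integral_phi_sq_add_psi_sq hB k]
    exact (intervalIntegral.integral_add
      (((continuous_phi B k).pow 2).intervalIntegrable _ _)
      (((continuous_psi B k).pow 2).intervalIntegrable _ _)).symm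
  rw [norm_phiL2_eq_norm_psiL2 hB] at h
  nlinarith [norm_nonneg (psiL2 B k)]

theorem norm_phiL2 {B : ℝ} (hB : 0 < B) (k : ℕ) : ‖phiL2 B k‖ = 1 :=
  (norm_phiL2_eq_norm_psiL2 hB k).trans (norm_psiL2 hB k)

/-- A function orthogonal to all smooth functions with compact support in `(0, B)` vanishes. -/
theorem eq_zero_of_forall_inner_eq_zero {B : ℝ} (f : L2Seg B)
    (h : ∀ g g' g'' : ℝ → ℝ, ∀ hg : Continuous g, (∀ x, HasDerivAt g (g' x) x) →
      (∀ x, HasDerivAt g' (g'' x) x) → Continuous g'' → g 0 = 0 → g' 0 = 0 → g B = 0 → g' B = 0 →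
      inner ℝ (toL2 B g hg) f = 0) : f = 0 := by
  have hf : Integrable f (segMeasure B) := (Lp.memLp f).integrable one_le_two
  have key : ∀ᵐ x ∂volume, x ∈ Ioo 0 B → f x = 0 := by
    refine isOpen_Ioo.ae_eq_zero_of_integral_contDiff_smul_eq_zero
      ((IntegrableOn.mono_set hf Ioo_subset_Icc_self).locallyIntegrableOn) fun g hg _ hsupp => ?_
    have hg' := (contDiff_infty_iff_deriv.1 hg).2
    -- The closed support avoids $0$ and $B$, so a test function is clamped at both ends and `h`
    -- applies to it.
    have hzero : ∀ x, x ∉ Ioo 0 B → g x = 0 ∧ deriv g x = 0 := fun x hx => by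
      have hx' : x ∉ tsupport g := fun h => hx (hsupp h)
      exact ⟨image_eq_zero_of_notMem_tsupport hx',
        image_eq_zero_of_notMem_tsupport fun h => hx' (tsupport_deriv_subset h)⟩
    have h0 := hzero 0 (by simp)
    have h1 := hzero B (by simp)
    have := h g (deriv g) (deriv (deriv g)) hg.continuous
      (fun x => (hg.differentiable (by simp) x).hasDerivAt)
      (fun x => (hg'.differentiable (by simp) x).hasDerivAt)
      (contDiff_infty_iff_deriv.1 hg').2.continuous h0.1 h0.2 h1.1 h1.2
    rw [inner_toL2_left] at this
    rw [← this]
    symm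
    refine setIntegral_eq_integral_of_forall_compl_eq_zero fun x hx => ?_
    rw [(hzero x fun h => hx (Ioo_subset_Icc_self h)).1, zero_mul]
  have key' := (ae_restrict_iff' measurableSet_Ioo).2 key
  rw [Measure.restrict_congr_set Ioo_ae_eq_Icc] at key'
  exact Lp.eq_zero_iff_ae_eq_zero.2 key'

/-- A function $g$ clamped at $0$ equals $\gamma^*g''$, so it is orthogonal to the kernel of
$\gamma$; such $g$ include all test functions. -/
theorem callOp_injective {B : ℝ} {f : L2Seg B} (hf : callOp B f = 0) : f = 0 := by
  refine eq_zero_of_forall_inner_eq_zero f fun g g' g'' hg h1 h2 hc h3 h4 _ _ => ?_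
  have : putOp B (toL2 B g'' hc) = toL2 B g hg := putOp_toL2 _ _ fun ξ hξ => by
    rw [putFun_eq_of_hasDerivAt h1 h2 hc hξ, h3, h4]
    ring
  rw [← this, inner_putOp_left, hf, inner_zero_right]

theorem putOp_injective {B : ℝ} {f : L2Seg B} (hf : putOp B f = 0) : f = 0 := by
  refine eq_zero_of_forall_inner_eq_zero f fun g g' g'' hg h1 h2 hc _ _ h3 h4 => ?_
  have : callOp B (toL2 B g'' hc) = toL2 B g hg := callOp_toL2 _ _ fun ξ hξ => by
    rw [callFun_eq_of_hasDerivAt h1 h2 hc hξ, h3, h4]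
    ring
  rw [← this, real_inner_comm, ← inner_putOp_left, hf, inner_zero_left]

/-! ### Compactness of the call operator -/

theorem norm_toL2_sub_le {B C : ℝ} (hC0 : 0 ≤ C) {f g : ℝ → ℝ} (hf : Continuous f)
    (hg : Continuous g) (h : ∀ x ∈ Icc 0 B, |f x - g x| ≤ C) :
    ‖toL2 B f hf - toL2 B g hg‖ ≤
      (measureUnivNNReal (segMeasure B) : ℝ) ^ ((2 : ENNReal).toReal)⁻¹ * C := by
  refine Lp.norm_le_of_ae_bound hC0 ?_
  filter_upwards [Lp.coeFn_sub (toL2 B f hf) (toL2 B g hg), toL2_ae B hf, toL2_ae B hg,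
    ae_restrict_mem measurableSet_Icc] with x h1 h2 h3 hx
  rw [h1, Pi.sub_apply, h2, h3]
  exact h x hx

/-- Cauchy–Schwarz. The Lipschitz constant depends on $f$ only through its norm, which supplies the
equicontinuity for Arzelà–Ascoli. -/
theorem abs_integral_kernel_sub_le {B : ℝ} {K : ℝ → ℝ → ℝ}
    (hK : Continuous (fun p : ℝ × ℝ => K p.1 p.2))
    (hL : ∀ ξ η x, |K ξ x - K η x| ≤ |ξ - η|) (f : L2Seg B) (ξ η : ℝ) :
    |(∫ x in Icc 0 B, K ξ x * f x) - ∫ x in Icc 0 B, K η x * f x| ≤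
      (measureUnivNNReal (segMeasure B) : ℝ) ^ ((2 : ENNReal).toReal)⁻¹ * ‖f‖ * |ξ - η| := by
  rw [integral_kernel_eq_inner hK, integral_kernel_eq_inner hK, ← inner_sub_left]
  refine (abs_real_inner_le_norm _ _).trans ?_
  rw [mul_right_comm]
  exact mul_le_mul_of_nonneg_right
    (norm_toL2_sub_le (abs_nonneg _) _ _ fun x _ => hL ξ η x) (norm_nonneg _)

theorem continuous_integral_kernel {B : ℝ} {K : ℝ → ℝ → ℝ}
    (hK : Continuous (fun p : ℝ × ℝ => K p.1 p.2))
    (hL : ∀ ξ η x, |K ξ x - K η x| ≤ |ξ - η|) (f : L2Seg B) :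
    Continuous fun ξ => ∫ x in Icc 0 B, K ξ x * f x :=
  (LipschitzWith.of_dist_le' fun ξ η => abs_integral_kernel_sub_le hK hL f ξ η).continuous

theorem abs_theta_sub_le (ξ η x : ℝ) : |theta ξ x - theta η x| ≤ |ξ - η| := by
  have h := abs_max_sub_max_le_abs (x - ξ) (x - η) 0
  rwa [sub_sub_sub_cancel_left, abs_sub_comm η ξ] at h

theorem abs_thetaStar_sub_le (ξ η x : ℝ) : |thetaStar ξ x - thetaStar η x| ≤ |ξ - η| := by
  have h := abs_max_sub_max_le_abs (ξ - x) (η - x) 0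
  rwa [sub_sub_sub_cancel_right] at h

theorem continuous_callFun {B : ℝ} (f : L2Seg B) : Continuous (callFun B f) :=
  continuous_integral_kernel continuous_theta abs_theta_sub_le f

theorem continuous_putFun {B : ℝ} (f : L2Seg B) : Continuous (putFun B f) :=
  continuous_integral_kernel continuous_thetaStar abs_thetaStar_sub_le f

/-- The operator factors as `J ∘ G` through the continuous functions on $[0,B]$: `G` maps the unit
ball to a bounded, equi-Lipschitz family, and the inclusion `J` is continuous. -/
theorem isCompactOperator_callOp {B : ℝ} (hB : 0 < B) : IsCompactOperator (callOp B) := by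
  set M : ℝ := (measureUnivNNReal (segMeasure B) : ℝ) ^ ((2 : ENNReal).toReal)⁻¹ with hM
  have hM0 : 0 ≤ M := by positivity
  let J : BoundedContinuousFunction (Icc 0 B) ℝ → L2Seg B := fun b =>
    toL2 B (IccExtend hB.le b) b.continuous.Icc_extend'
  have hJ : Continuous J := by
    refine (LipschitzWith.of_dist_le' (K := M) fun b b' => ?_).continuous
    rw [dist_eq_norm]
    exact norm_toL2_sub_le dist_nonneg _ _ fun x _ =>
      BoundedContinuousFunction.dist_coe_le_dist (f := b) (g := b') (projIcc 0 B hB.le x)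
  let G : L2Seg B → BoundedContinuousFunction (Icc 0 B) ℝ := fun f =>
    BoundedContinuousFunction.mkOfCompact
      ⟨fun ξ => callFun B f ξ, (continuous_callFun f).comp continuous_subtype_val⟩
  have hJG : ∀ f, J (G f) = callOp B f := fun f => by
    refine Lp.ext ((toL2_ae B _).trans (.trans ?_ (callOp_ae B f).symm))
    exact ae_of_forall_mem_Icc fun x hx => by rw [IccExtend_of_mem hB.le _ hx]; rfl
  set A := G '' Metric.closedBall 0 1 with hA
  have hcomp : IsCompact (closure A) := by
    refine BoundedContinuousFunction.arzela_ascoli (Metric.closedBall 0 (M * |B|))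
      (isCompact_closedBall _ _) A ?_ ?_
    · rintro _ x ⟨f, hf, rfl⟩
      rw [mem_closedBall_zero_iff] at hf ⊢
      refine (norm_integral_kernel_le continuous_theta (abs_theta_le B) f x.2).trans ?_
      exact mul_le_of_le_one_right (by positivity) hf
    · refine Metric.equicontinuous_of_continuity_modulus (fun r => M * r) ?_ _ ?_
      · simpa using (continuous_const_mul M).tendsto 0
      · rintro x y ⟨_, f, hf, rfl⟩
        rw [mem_closedBall_zero_iff] at hf
        refine (abs_integral_kernel_sub_le continuous_theta abs_theta_sub_le f x y).trans ?_
        exact mul_le_mul_of_nonneg_right (mul_le_of_le_one_right hM0 hf) (abs_nonneg _)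
  refine ⟨J '' closure A, hcomp.image hJ, Filter.mem_of_superset
    (Metric.closedBall_mem_nhds 0 one_pos) fun f hf => ?_⟩
  exact ⟨G f, subset_closure (mem_image_of_mem _ hf), hJG f⟩

/-! ### Eigenbases of symmetric operators -/

/-- Eigenvectors of a symmetric operator for different eigenvalues are orthogonal. Hence an
eigenvector for a value outside $\mu$ is orthogonal to every $v_k$ and vanishes. -/
theorem isSimpleEigenbasis_of_apply_eq {E : Type*} [NormedAddCommGroup E] [InnerProductSpace ℝ E]
    [CompleteSpace E] {T : E →L[ℝ] E} (hT : (T : E →ₗ[ℝ] E).IsSymmetric) {μ : ℕ → ℝ} {v : ℕ → E}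
    (hμ : Function.Injective μ) (hv : ∀ k, T (v k) = μ k • v k) (hn : ∀ k, ‖v k‖ = 1)
    (hc : ∀ w : E, (∀ k, inner ℝ (v k) w = 0) → w = 0) : IsSimpleEigenbasis T μ v := by
  have hinner : ∀ k c w, T w = c • w → c ≠ μ k → inner ℝ (v k) w = 0 := by
    intro k c w hw hck
    have h : inner ℝ (T (v k)) w = inner ℝ (v k) (T w) := hT (v k) w
    rw [hv, hw, real_inner_smul_left, real_inner_smul_right] at h
    have : (c - μ k) * inner ℝ (v k) w = 0 := by linear_combination -h
    exact (mul_eq_zero.1 this).resolve_left (sub_ne_zero.2 hck)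
  have hne : ∀ k, v k ≠ 0 := fun k h => by simpa [h] using hn k
  have ho : Orthonormal ℝ v := ⟨hn, fun i j hij =>
    hinner i (μ j) (v j) (hv j) fun h => hij (hμ h).symm⟩
  refine ⟨ho, ?_, fun c => ⟨fun h => ?_, ?_⟩, fun k => le_antisymm (fun w hw => ?_) ?_⟩
  · rw [Submodule.topologicalClosure_eq_top_iff, Submodule.eq_bot_iff]
    intro w hw
    exact hc w fun k => (Submodule.mem_orthogonal _ _).1 hw _ (Submodule.subset_span ⟨k, rfl⟩)
  · obtain ⟨w, hw⟩ := h.exists_hasEigenvector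
    by_contra! hcon
    exact hw.2 (hc w fun k => hinner k c w hw.apply_eq_smul (hcon k))
  · rintro ⟨k, rfl⟩
    exact Module.End.hasEigenvalue_of_hasEigenvector (x := v k)
      ⟨Module.End.mem_eigenspace_iff.2 (hv k), hne k⟩
  · have hw' : T w = μ k • w := Module.End.mem_eigenspace_iff.1 hw
    -- Removing the projection onto $v_k$ leaves a vector orthogonal to the whole system.
    have : w - inner ℝ (v k) w • v k = 0 := by
      refine hc _ fun j => ?_
      rw [inner_sub_right, real_inner_smul_right]
      rcases eq_or_ne j k with rfl | hjk
      · rw [real_inner_self_eq_norm_sq, hn]; ring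
      · rw [ho.2 hjk, hinner j (μ k) w hw' fun h => hjk (hμ h).symm]; ring
    rw [sub_eq_zero.1 this]
    exact Submodule.smul_mem _ _ (Submodule.mem_span_singleton_self _)
  · rw [Submodule.span_singleton_le_iff_mem]
    exact Module.End.mem_eigenspace_iff.2 (hv k)

/-! ### The boundary value problem -/

section ODE
variable {B κ : ℝ} {u u' u'' : ℝ → ℝ}

theorem eq_of_hasDerivAt_zero_Icc {w w' : ℝ → ℝ} (h : ∀ x, HasDerivAt w (w' x) x)
    (h0 : ∀ x ∈ Icc 0 B, w' x = 0) {x : ℝ} (hx : x ∈ Icc 0 B) : w x = w 0 :=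
  constant_of_has_deriv_right_zero (fun y _ => (h y).continuousAt.continuousWithinAt)
    (fun y hy => by
      have := h y
      rw [h0 y ⟨hy.1, hy.2.le⟩] at this
      exact this.hasDerivWithinAt) x hx

/-- The combinations $\kappa u\cosh-u'\sinh$ and $u'\cosh-\kappa u\sinh$ are first integrals;
solving for $u$ and $u'$ uses $\cosh^2-\sinh^2=1$. The circular case is parallel. -/
theorem eq_hyperbolic_of_deriv2 (hκ : κ ≠ 0) (hu : ∀ x, HasDerivAt u (u' x) x)
    (hu' : ∀ x, HasDerivAt u' (u'' x) x) (h : ∀ x ∈ Icc 0 B, u'' x = κ ^ 2 * u x)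
    {x : ℝ} (hx : x ∈ Icc 0 B) :
    u x = u 0 * Real.cosh (κ * x) + u' 0 / κ * Real.sinh (κ * x) ∧
    u' x = κ * (u 0 * Real.sinh (κ * x) + u' 0 / κ * Real.cosh (κ * x)) := by
  have e1 := eq_of_hasDerivAt_zero_Icc (fun x => (((hu x).mul
    (hasDerivAt_cosh_mul κ x)).const_mul κ).sub ((hu' x).mul (hasDerivAt_sinh_mul κ x)))
    (fun x hx => by rw [h x hx]; ring) hx
  have e2 := eq_of_hasDerivAt_zero_Icc (fun x => ((hu' x).mul (hasDerivAt_cosh_mul κ x)).sub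
    (((hu x).mul (hasDerivAt_sinh_mul κ x)).const_mul κ))
    (fun x hx => by rw [h x hx]; ring) hx
  simp only [Pi.sub_apply, Pi.mul_apply, mul_zero, Real.cosh_zero, Real.sinh_zero] at e1 e2
  have hc := Real.cosh_sq (κ * x)
  constructor
  · field_simp
    linear_combination Real.cosh (κ * x) * e1 + Real.sinh (κ * x) * e2 - κ * u x * hc
  · field_simp
    linear_combination Real.sinh (κ * x) * e1 + Real.cosh (κ * x) * e2 - u' x * hc

theorem eq_circular_of_deriv2 (hκ : κ ≠ 0) (hu : ∀ x, HasDerivAt u (u' x) x)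
    (hu' : ∀ x, HasDerivAt u' (u'' x) x) (h : ∀ x ∈ Icc 0 B, u'' x = -(κ ^ 2 * u x))
    {x : ℝ} (hx : x ∈ Icc 0 B) :
    u x = u 0 * Real.cos (κ * x) + u' 0 / κ * Real.sin (κ * x) ∧
    u' x = κ * (-(u 0 * Real.sin (κ * x)) + u' 0 / κ * Real.cos (κ * x)) := by
  have e1 := eq_of_hasDerivAt_zero_Icc (fun x => (((hu x).mul
    (hasDerivAt_cos_mul κ x)).const_mul κ).sub ((hu' x).mul (hasDerivAt_sin_mul κ x)))
    (fun x hx => by rw [h x hx]; ring) hx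
  have e2 := eq_of_hasDerivAt_zero_Icc (fun x => ((hu' x).mul (hasDerivAt_cos_mul κ x)).add
    (((hu x).mul (hasDerivAt_sin_mul κ x)).const_mul κ))
    (fun x hx => by rw [h x hx]; ring) hx
  simp only [Pi.sub_apply, Pi.add_apply, Pi.mul_apply, mul_zero, Real.cos_zero,
    Real.sin_zero] at e1 e2
  have hc := Real.sin_sq_add_cos_sq (κ * x)
  constructor
  · field_simp
    linear_combination Real.cos (κ * x) * e1 + Real.sin (κ * x) * e2 - κ * u x * hc
  · field_simp
    linear_combination -Real.sin (κ * x) * e1 + Real.cos (κ * x) * e2 - u' x * hc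

/-- A solution of `p'' = κ² q`, `q'' = κ² p` with clamped end for `p` at `0` and for `q` at `B`
is a multiple of some `φ_k`. -/
theorem exists_eq_mul_phi (hB : 0 < B) (hκ : 0 < κ) {p p' p'' q q' q'' : ℝ → ℝ}
    (hp : ∀ x, HasDerivAt p (p' x) x) (hp' : ∀ x, HasDerivAt p' (p'' x) x)
    (hq : ∀ x, HasDerivAt q (q' x) x) (hq' : ∀ x, HasDerivAt q' (q'' x) x)
    (hpq : ∀ x ∈ Icc 0 B, p'' x = κ ^ 2 * q x) (hqp : ∀ x ∈ Icc 0 B, q'' x = κ ^ 2 * p x)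
    (hp0 : p 0 = 0) (hp0' : p' 0 = 0) (hqB : q B = 0) (hqB' : q' B = 0) :
    ∃ (k : ℕ) (a : ℝ), ∀ x ∈ Icc 0 B, p x = a * phi B k x := by
  have hs := fun x (hx : x ∈ Icc 0 B) => eq_hyperbolic_of_deriv2 hκ.ne'
    (fun x => (hp x).add (hq x)) (fun x => (hp' x).add (hq' x))
    (fun x hx => by rw [hpq x hx, hqp x hx, Pi.add_apply]; ring) hx
  have hd := fun x (hx : x ∈ Icc 0 B) => eq_circular_of_deriv2 hκ.ne'
    (fun x => (hp x).sub (hq x)) (fun x => (hp' x).sub (hq' x))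
    (fun x hx => by rw [hpq x hx, hqp x hx, Pi.sub_apply]; ring) hx
  simp only [Pi.add_apply, Pi.sub_apply, hp0, hp0'] at hs hd
  set a := q 0
  set b := q' 0 / κ with hb
  have hsol : ∀ x ∈ Icc 0 B, p x = a / 2 * (Real.cosh (κ * x) - Real.cos (κ * x)) +
      b / 2 * (Real.sinh (κ * x) - Real.sin (κ * x)) := fun x hx => by
    linear_combination ((hs x hx).1 + (hd x hx).1) / 2
  have hBm : B ∈ Icc 0 B := ⟨hB.le, le_rfl⟩
  obtain ⟨s1, s2⟩ := hs B hBm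
  obtain ⟨d1, d2⟩ := hd B hBm
  -- Clamping $q$ at $B$ gives a homogeneous $2\times2$ system in $a,b$ with determinant
  -- $2(1+\cosh(\kappa B)\cos(\kappa B))$.
  have f1 : a * (Real.cosh (κ * B) + Real.cos (κ * B)) +
      b * (Real.sinh (κ * B) + Real.sin (κ * B)) = 0 := by
    linear_combination 2 * hqB - s1 + d1
  have f2 : a * (Real.sinh (κ * B) - Real.sin (κ * B)) +
      b * (Real.cosh (κ * B) + Real.cos (κ * B)) = 0 := by
    have : κ * (a * (Real.sinh (κ * B) - Real.sin (κ * B)) +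
      b * (Real.cosh (κ * B) + Real.cos (κ * B))) = 0 := by
      linear_combination 2 * hqB' - s2 + d2
    exact (mul_eq_zero.1 this).resolve_left hκ.ne'
  have hρ : 0 < κ * B := by positivity
  have hpos : 0 < Real.cosh (κ * B) + Real.cos (κ * B) := by
    have := Real.one_lt_cosh.2 hρ.ne'
    linarith [Real.neg_one_le_cos (κ * B)]
  by_cases hdet : Real.cosh (κ * B) * Real.cos (κ * B) = -1
  · obtain ⟨k, hk⟩ := exists_eq_rho hρ hdet
    have hκk : κ = rho k / B := by rw [← hk]; field_simp
    obtain ⟨-, v2, -, v4⟩ := slope_values k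
    rw [hk] at f2 hpos
    -- The sum of `v2` and `v4` identifies the slope as $(\sinh\rho-\sin\rho)/(\cosh\rho+\cos\rho)$,
    -- so `f2` determines $b$.
    have hbs : b = -(a * slope k) := by
      refine mul_right_cancel₀ hpos.ne' ?_
      linear_combination f2 + a * (v2 + v4)
    refine ⟨k, a / 2 * Real.sqrt B, fun x hx => ?_⟩
    have hsB : Real.sqrt B * (1 / Real.sqrt B) = 1 :=
      mul_one_div_cancel (Real.sqrt_pos.2 hB).ne'
    rw [phi_eq, hsol x hx, hbs, mul_assoc, ← mul_assoc (Real.sqrt B), hsB, hκk]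
    ring
  · have hc := Real.cosh_sq (κ * B)
    have hs := Real.sin_sq_add_cos_sq (κ * B)
    have ha : a = 0 := by
      have : a * (1 + Real.cosh (κ * B) * Real.cos (κ * B)) = 0 := by
        linear_combination ((Real.cosh (κ * B) + Real.cos (κ * B)) * f1 -
          (Real.sinh (κ * B) + Real.sin (κ * B)) * f2 - a * hc - a * hs) / 2
      exact (mul_eq_zero.1 this).resolve_right fun h => hdet (by linarith)
    have hb0 : b = 0 := by
      rw [ha, zero_mul, zero_add] at f2
      exact (mul_eq_zero.1 f2).resolve_right hpos.ne'
    exact ⟨0, 0, fun x hx => by rw [hsol x hx, ha, hb0]; ring⟩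

end ODE

/-! ### Completeness -/

/-- An eigenvector has a regular representative, since $f=c^{-1}\gamma^*\gamma f$ almost everywhere;
that representative solves the boundary value problem. -/
theorem mem_span_phiL2_of_eigen {B : ℝ} (hB : 0 < B) {c : ℝ} {f : L2Seg B}
    (hf : putOp B (callOp B f) = c • f) : f ∈ Submodule.span ℝ (range (phiL2 B)) := by
  rcases eq_or_ne f 0 with rfl | hf0
  · exact Submodule.zero_mem _
  -- $c\|f\|^2=\|\gamma f\|^2$, and $\gamma$ is injective.
  have hc : 0 < c := by
    have h : c * ‖f‖ ^ 2 = ‖callOp B f‖ ^ 2 := by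
      rw [← real_inner_self_eq_norm_sq, ← real_inner_self_eq_norm_sq, ← inner_putOp_left, hf,
        real_inner_smul_left]
    have h1 : 0 < ‖callOp B f‖ := norm_pos_iff.2 fun h => hf0 (callOp_injective h)
    have h2 : 0 < ‖f‖ := norm_pos_iff.2 hf0
    refine pos_of_mul_pos_left (b := ‖f‖ ^ 2) ?_ (by positivity)
    rw [h]
    positivity
  set κ := Real.sqrt (Real.sqrt c⁻¹) with hκ
  have hκ0 : 0 < κ := by positivity
  have hκ4 : κ ^ 2 * κ ^ 2 = c⁻¹ := by
    rw [hκ, Real.sq_sqrt (by positivity), Real.mul_self_sqrt (by positivity)]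
  have hG := continuous_callFun f
  set g := callFun B f with hg
  set F : ℝ → ℝ := fun x => c⁻¹ * putFun B g x with hF
  have hfF : f =ᵐ[segMeasure B] F := by
    have h : f = c⁻¹ • putOp B (callOp B f) := by rw [hf, inv_smul_smul₀ hc.ne']
    have h3 : f =ᵐ[segMeasure B] ⇑(c⁻¹ • putOp B (callOp B f)) := by rw [← h]
    filter_upwards [Lp.coeFn_smul c⁻¹ (putOp B (callOp B f)), putOp_ae B (callOp B f), h3]
      with x h1 h2 h3
    rw [h3, h1, Pi.smul_apply, h2, smul_eq_mul, putFun_congr (callOp_ae B f)]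
  have hgF : g = callFun B F := callFun_congr hfF
  have hFc : Continuous F := by
    have := continuous_putFun (callOp B f)
    rw [putFun_congr (callOp_ae B f)] at this
    exact this.const_mul c⁻¹
  obtain ⟨v, v', hv, hv'⟩ := exists_double_primitive hG
  obtain ⟨u, u', hu, hu'⟩ := exists_double_primitive hFc
  have hp : ∀ x ∈ Icc 0 B, c⁻¹ * (v x - v 0 - x * v' 0) = F x := fun x hx => by
    rw [hF, ← putFun_eq_of_hasDerivAt hv hv' hG hx]
  have hq : ∀ x ∈ Icc 0 B, u x - u B - (x - B) * u' B = g x := fun x hx => by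
    rw [hgF, callFun_eq_of_hasDerivAt hu hu' hFc hx]
  -- Here $p=F$ and $q=\kappa^2\gamma F$ on $[0,B]$. Both are written through double primitives,
  -- which are differentiable on the whole line and make the clamping explicit.
  obtain ⟨k, a, hka⟩ := exists_eq_mul_phi hB hκ0
    (fun x => (((hv x).sub_const (v 0)).sub ((hasDerivAt_id x).mul_const (v' 0))).const_mul c⁻¹)
    (fun x => ((hv' x).sub_const (1 * v' 0)).const_mul c⁻¹)
    (fun x => (((hu x).sub_const (u B)).sub
      (((hasDerivAt_id x).sub_const B).mul_const (u' B))).const_mul (κ ^ 2))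
    (fun x => ((hu' x).sub_const (1 * u' B)).const_mul (κ ^ 2))
    (fun x hx => by
      have := hq x hx
      simp only [Pi.sub_apply, id_eq]
      rw [this, ← mul_assoc, hκ4])
    (fun x hx => by
      have := hp x hx
      simp only [Pi.sub_apply, id_eq]
      rw [this])
    (by simp) (by simp) (by simp) (by simp)
  have hfa : f = a • phiL2 B k := by
    rw [phiL2, ← toL2_const_mul]
    refine Lp.ext (hfF.trans (.trans ?_ (toL2_ae B _).symm))
    exact ae_of_forall_mem_Icc fun x hx => (hp x hx).symm.trans (hka x hx)
  rw [hfa]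
  exact Submodule.smul_mem _ _ (Submodule.subset_span ⟨k, rfl⟩)

theorem isSymmetric_putOp_comp_callOp (B : ℝ) :
    ((putOp B ∘L callOp B : L2Seg B →L[ℝ] L2Seg B) : L2Seg B →ₗ[ℝ] L2Seg B).IsSymmetric := by
  intro f g
  change inner ℝ (putOp B (callOp B f)) g = inner ℝ f (putOp B (callOp B g))
  rw [inner_putOp_left, real_inner_comm _ f, inner_putOp_left, real_inner_comm]

theorem isSymmetric_callOp_comp_putOp (B : ℝ) :
    ((callOp B ∘L putOp B : L2Seg B →L[ℝ] L2Seg B) : L2Seg B →ₗ[ℝ] L2Seg B).IsSymmetric := by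
  intro f g
  change inner ℝ (callOp B (putOp B f)) g = inner ℝ f (callOp B (putOp B g))
  rw [← inner_putOp_left, real_inner_comm g, ← inner_putOp_left, real_inner_comm]

/-- By the spectral theorem only $0$ is orthogonal to all eigenspaces of the compact symmetric
operator $\gamma^*\gamma$, and these lie in the span of the $\phi_k$. -/
theorem eq_zero_of_forall_inner_phiL2 {B : ℝ} (hB : 0 < B) {f : L2Seg B}
    (hf : ∀ k, inner ℝ (phiL2 B k) f = 0) : f = 0 := by
  have hbot := ContinuousLinearMap.orthogonalComplement_iSup_eigenspaces_eq_bot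
    ((isCompactOperator_callOp hB).clm_comp (putOp B)) (isSymmetric_putOp_comp_callOp B)
  rw [← Submodule.mem_bot ℝ, ← hbot]
  have hle : (⨆ c, Module.End.eigenspace
      ((putOp B ∘L callOp B : L2Seg B →L[ℝ] L2Seg B) : L2Seg B →ₗ[ℝ] L2Seg B) c) ≤
      Submodule.span ℝ (range (phiL2 B)) :=
    iSup_le fun c g hg => mem_span_phiL2_of_eigen hB (Module.End.mem_eigenspace_iff.1 hg)
  refine Submodule.orthogonal_le hle ?_
  rw [Submodule.mem_orthogonal]
  intro g hg
  induction hg using Submodule.span_induction with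
  | mem x hx => obtain ⟨k, rfl⟩ := hx; exact hf k
  | zero => exact inner_zero_left _
  | add x y _ _ hx hy => rw [inner_add_left, hx, hy, add_zero]
  | smul r x _ hx => rw [real_inner_smul_left, hx, mul_zero]

/-- $\langle\phi_k,\gamma^*f\rangle=\lambda_k\langle\psi_k,f\rangle=0$ for all $k$ forces
$\gamma^*f=0$; no second spectral argument is needed. -/
theorem eq_zero_of_forall_inner_psiL2 {B : ℝ} (hB : 0 < B) {f : L2Seg B}
    (hf : ∀ k, inner ℝ (psiL2 B k) f = 0) : f = 0 := by
  refine putOp_injective (eq_zero_of_forall_inner_phiL2 hB fun k => ?_)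
  rw [real_inner_comm, inner_putOp_left, callOp_phiL2 hB, real_inner_smul_right,
    real_inner_comm, hf, mul_zero]

theorem injective_lam_sq {B : ℝ} (hB : 0 < B) : Function.Injective fun k => lam B k ^ 2 :=
  fun j k h => (strictAnti_lam hB).injective
    ((pow_left_inj₀ (lam_pos hB j).le (lam_pos hB k).le two_ne_zero).1 h)

theorem isSimpleEigenbasis_phiL2 {B : ℝ} (hB : 0 < B) :
    IsSimpleEigenbasis (putOp B ∘L callOp B) (fun k => lam B k ^ 2) (phiL2 B) := by
  refine isSimpleEigenbasis_of_apply_eq (isSymmetric_putOp_comp_callOp B) (injective_lam_sq hB)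
    (fun k => ?_) (norm_phiL2 hB) fun f hf => eq_zero_of_forall_inner_phiL2 hB hf
  rw [ContinuousLinearMap.comp_apply, callOp_phiL2 hB, map_smul, putOp_psiL2 hB, smul_smul, sq]

theorem isSimpleEigenbasis_psiL2 {B : ℝ} (hB : 0 < B) :
    IsSimpleEigenbasis (callOp B ∘L putOp B) (fun k => lam B k ^ 2) (psiL2 B) := by
  refine isSimpleEigenbasis_of_apply_eq (isSymmetric_callOp_comp_putOp B) (injective_lam_sq hB)
    (fun k => ?_) (norm_psiL2 hB) fun f hf => eq_zero_of_forall_inner_psiL2 hB hf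
  rw [ContinuousLinearMap.comp_apply, putOp_psiL2 hB, map_smul, callOp_phiL2 hB, smul_smul, sq]

/-! ### Regularity -/

theorem iteratedDerivWithin_lam_mul_psi {B : ℝ} (hB : 0 < B) (k : ℕ) {ξ : ℝ}
    (hξ : ξ ∈ Icc 0 B) :
    iteratedDerivWithin 2 (fun x => lam B k * psi B k x) (Icc 0 B) ξ = phi B k ξ :=
  iteratedDerivWithin_two_eq hB (contDiff_const.mul (contDiff_psi B k))
    (fun x => (hasDerivAt_psi B k x).const_mul (lam B k)) (hasDerivAt_lam_mul_dpsi hB k) hξ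

theorem iteratedDerivWithin_lam_mul_phi {B : ℝ} (hB : 0 < B) (k : ℕ) {ξ : ℝ}
    (hξ : ξ ∈ Icc 0 B) :
    iteratedDerivWithin 2 (fun x => lam B k * phi B k x) (Icc 0 B) ξ = psi B k ξ :=
  iteratedDerivWithin_two_eq hB (contDiff_const.mul (contDiff_phi B k))
    (fun x => (hasDerivAt_phi B k x).const_mul (lam B k)) (hasDerivAt_lam_mul_dphi hB k) hξ

end RestrictedOptions

end

open RestrictedOptions in
theorem mainTheorem1 (B : ℝ) (hB : 0 < B) :
    -- the put operator is the Hilbert-space adjoint of the call operator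
    putOp B = ContinuousLinearMap.adjoint (callOp B) ∧
    -- `β_k` is the smallest positive solution of the fixed point equation
    (∀ k, IsLeast (fixedPointSet k) (beta k)) ∧
    -- the singular values are positive and decreasing
    (∀ k, 0 < rho k) ∧ (∀ k, 0 < lam B k) ∧ StrictAnti (lam B) ∧
    -- the two expressions for `a_{k,2}` agree
    (∀ k, a2 B k = 1 / Real.sqrt B * (1 / (1 + (-1) ^ k * Real.exp (-rho k)))) ∧
    -- the eigenvectors and eigenvalues of `γ*γ` and `γγ*`
    IsSimpleEigenbasis (putOp B ∘L callOp B) (fun k => lam B k ^ 2) (phiL2 B) ∧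
    IsSimpleEigenbasis (callOp B ∘L putOp B) (fun k => lam B k ^ 2) (psiL2 B) ∧
    ∀ k : ℕ,
      -- `γ φ_k = λ_k ψ_k` and `γ* ψ_k = λ_k φ_k`, in `L²` and pointwise on `[0, B]`
      callOp B (phiL2 B k) = lam B k • psiL2 B k ∧
      putOp B (psiL2 B k) = lam B k • phiL2 B k ∧
      (∀ ξ ∈ Set.Icc 0 B, callFun B (phi B k) ξ = lam B k * psi B k ξ) ∧
      (∀ ξ ∈ Set.Icc 0 B, putFun B (psi B k) ξ = lam B k * phi B k ξ) ∧
      -- unit norms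
      ‖phiL2 B k‖ = 1 ∧ ‖psiL2 B k‖ = 1 ∧
      -- boundary conditions
      psi B k B = 0 ∧ HasDerivAt (psi B k) 0 B ∧
      phi B k 0 = 0 ∧ HasDerivAt (phi B k) 0 0 ∧
      -- reflection symmetry
      (∀ ξ ∈ Set.Icc 0 B, psi B k (B - ξ) = (-1) ^ k * phi B k ξ) ∧
      (∀ ξ ∈ Set.Icc 0 B, phi B k (B - ξ) = (-1) ^ k * psi B k ξ) ∧
      -- second derivatives on `[0, B]` (one-sided at the end points)
      ContDiffOn ℝ 2 (psi B k) (Set.Icc 0 B) ∧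
      ContDiffOn ℝ 2 (phi B k) (Set.Icc 0 B) ∧
      ContDiffOn ℝ 2 (callFun B (phi B k)) (Set.Icc 0 B) ∧
      ContDiffOn ℝ 2 (putFun B (psi B k)) (Set.Icc 0 B) ∧
      (∀ ξ ∈ Set.Icc 0 B,
        lam B k * iteratedDerivWithin 2 (psi B k) (Set.Icc 0 B) ξ =
          iteratedDerivWithin 2 (callFun B (phi B k)) (Set.Icc 0 B) ξ ∧
        iteratedDerivWithin 2 (callFun B (phi B k)) (Set.Icc 0 B) ξ = phi B k ξ) ∧
      (∀ ξ ∈ Set.Icc 0 B,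
        lam B k * iteratedDerivWithin 2 (phi B k) (Set.Icc 0 B) ξ =
          iteratedDerivWithin 2 (putFun B (psi B k)) (Set.Icc 0 B) ξ ∧
        iteratedDerivWithin 2 (putFun B (psi B k)) (Set.Icc 0 B) ξ = psi B k ξ) := by
  refine ⟨putOp_eq_adjoint B, isLeast_beta, rho_pos, lam_pos hB, strictAnti_lam hB, a2_eq B,
    isSimpleEigenbasis_phiL2 hB, isSimpleEigenbasis_psiL2 hB, fun k => ?_⟩
  have hcall : Set.EqOn (callFun B (phi B k)) (fun x => lam B k * psi B k x) (Set.Icc 0 B) :=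
    fun ξ hξ => callFun_phi hB k hξ
  have hput : Set.EqOn (putFun B (psi B k)) (fun x => lam B k * phi B k x) (Set.Icc 0 B) :=
    fun ξ hξ => putFun_psi hB k hξ
  refine ⟨callOp_phiL2 hB k, putOp_psiL2 hB k, hcall, hput, norm_phiL2 hB k, norm_psiL2 hB k,
    psi_end hB k, dpsi_end hB k ▸ hasDerivAt_psi B k B, phi_zero B k,
    by simpa only [dphi_zero] using hasDerivAt_phi B k 0, fun ξ _ => psi_reflect hB k ξ,
    fun ξ _ => phi_reflect hB k ξ, (contDiff_psi B k).contDiffOn, (contDiff_phi B k).contDiffOn,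
    (contDiff_const.mul (contDiff_psi B k)).contDiffOn.congr hcall,
    (contDiff_const.mul (contDiff_phi B k)).contDiffOn.congr hput, fun ξ hξ => ?_, fun ξ hξ => ?_⟩
  -- The formula for $\gamma\phi_k$ holds only on $[0,B]$, which suffices because derivatives within
  -- the segment see only values there.
  · rw [iteratedDerivWithin_congr hcall hξ, iteratedDerivWithin_lam_mul_psi hB k hξ,
      iteratedDerivWithin_two_eq hB (contDiff_psi B k) (hasDerivAt_psi B k)
        (hasDerivAt_dpsi B k) hξ, ← mul_assoc, lam_mul_sq hB, one_mul]
    exact ⟨rfl, rfl⟩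
  · rw [iteratedDerivWithin_congr hput hξ, iteratedDerivWithin_lam_mul_phi hB k hξ,
      iteratedDerivWithin_two_eq hB (contDiff_phi B k) (hasDerivAt_phi B k)
        (hasDerivAt_dphi B k) hξ, ← mul_assoc, lam_mul_sq hB, one_mul]
    exact ⟨rfl, rfl⟩
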